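/- Let $n\ge 2$ be even. A subgroup $H$ of a group $G$ is called a Howe subgroup of $G$ if $\mathrm C_G(\mathrm C_G(H))=H$, where $\mathrm C_G$ denotes the centralizer in $G$. For a subgroup $H\subseteq \mathrm O(n)$ put $\mathrm SH=\mathrm{SO}(n)\cap H$. A Howe subgroup $H$ of $\mathrm O(n)$ is called $\mathrm S$-admissible if $\mathrm SH$ is a Howe subgroup of $\mathrm{SO}(n)$ and no Howe subgroup of $\mathrm O(n)$ strictly smaller than $H$ contains $\mathrm SH$. Let $H$ be a Howe subgroup of $\mathrm O(n)$. The (irreducible) factors of $H$ are the restrictions $H|_W=\{h|_W : h\in H\}$ of $H$ to the subspaces $W\subseteq\mathbb R^n$ that are irreducible under the representation $(h,c)\mapsto hc$ of $H\times\mathrm C_{\mathrm O(n)}(H)$ on $\mathbb R^n$. For integers $m,k\ge 1$, a factor $H|_W$ is called an $\mathrm O$-factor of rank $m$ and multiplicity $k$ if some linear isometry $\mathbb R^{m}\otimes\mathbb R^k\to W$ carries $\{a\otimes \mathbf 1_k : a\in\mathrm O(m)\}$ to $H|_W$, and it is called a $\mathrm U$-factor of rank $m$ and multiplicity $k$ if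 some linear isometry $\mathbb R^{2m}\otimes\mathbb R^k\to W$ carries $\{\varphi(a)\otimes \mathbf 1_k : a\in\mathrm U(m)\}$ to $H|_W$, where $\varphi(a_1+\mathrm i a_2)=\begin{bmatrix} a_1 & a_2\\ -a_2 & a_1\end{bmatrix}$ for real $m\times m$ matrices $a_1,a_2$. Proposition. Let $H$ be an $\mathrm S$-admissible Howe subgroup of $\mathrm O(n)$. Consider the set of $\mathrm{SO}(n)$-conjugacy classes of the subgroups $\mathrm S(gHg^{-1})$, $g\in\mathrm O(n)$. All members of these classes are Howe subgroups of $\mathrm{SO}(n)$. There is exactly one such class if and only if at least one of the following holds: - $H$ has an $\mathrm O$-factor of odd rank or of odd multiplicity; - $H$ has a $\mathrm U$-factor of odd rank and odd multiplicity. Otherwise there are exactly two such classes, and they are distinct: the class of $\mathrm SH$ and the class of $\mathrm S(aHa^{-1})$ for some $a\in\mathrm O(n)$ with negative determinant. -/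

import Mathlib

open scoped Kronecker

namespace Howe

/-- A Howe subgroup of a group `G`: a subgroup which equals its double centralizer in `G`. -/
def IsHowe {G : Type*} [Group G] (H : Subgroup G) : Prop :=
  Subgroup.centralizer (Subgroup.centralizer (H : Set G) : Set G) = H

/-- The conjugate subgroup `g H g⁻¹`. -/
def conj {G : Type*} [Group G] (g : G) (H : Subgroup G) : Subgroup G :=
  H.map (MulAut.conj g).toMonoidHom

/-- The conjugacy class of a subgroup `H` of `G`, i.e. the set of all `g H g⁻¹`, `g ∈ G`. -/
def conjClass {G : Type*} [Group G] (H : Subgroup G) : Set (Subgroup G) :=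
  Set.range fun g : G => conj g H

/-- The orthogonal group `O(n)`. -/
abbrev O (n : ℕ) : Type := Matrix.orthogonalGroup (Fin n) ℝ

/-- The special orthogonal group `SO(n)`. -/
abbrev SO (n : ℕ) : Type := Matrix.specialOrthogonalGroup (Fin n) ℝ

/-- The inclusion homomorphism `SO(n) → O(n)`. -/
def incl (n : ℕ) : SO n →* O n :=
  Submonoid.inclusion Matrix.specialUnitaryGroup_le_unitaryGroup

/-- The intersection `S H = SO(n) ∩ H`, as a subgroup of `SO(n)`. -/
def S {n : ℕ} (H : Subgroup (O n)) : Subgroup (SO n) :=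
  H.comap (incl n)

/-- `S`-admissible Howe subgroups `H` of `O(n)`: `H` is a Howe subgroup of `O(n)`, the
intersection `S H` is a Howe subgroup of `SO(n)`, and there is no Howe subgroup of `O(n)` which
contains `S H` and is smaller than `H`. -/
def IsSAdmissible {n : ℕ} (H : Subgroup (O n)) : Prop :=
  IsHowe H ∧ IsHowe (S H) ∧
    ¬ ∃ K : Subgroup (O n), IsHowe K ∧ (S H).map (incl n) ≤ K ∧ K < H

/-- The linear action of an element of `O(n)` on Euclidean space `ℝⁿ`. -/
noncomputable def act {n : ℕ} (h : O n) : EuclideanSpace ℝ (Fin n) →ₗ[ℝ] EuclideanSpace ℝ (Fin n) :=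
  Matrix.toEuclideanLin (h : Matrix (Fin n) (Fin n) ℝ)

/-- `W` is invariant under the representation `(h, c) ↦ h c` of `H × C_{O(n)}(H)` on `ℝⁿ`. -/
def IsInvariant {n : ℕ} (H : Subgroup (O n)) (W : Submodule ℝ (EuclideanSpace ℝ (Fin n))) : Prop :=
  ∀ h ∈ H, ∀ c ∈ Subgroup.centralizer (H : Set (O n)), ∀ w ∈ W, act (h * c) w ∈ W

/-- `W` is an irreducible subspace of `ℝⁿ` under the representation of `H × C_{O(n)}(H)`. -/
def IsIrreducibleSubspace {n : ℕ} (H : Subgroup (O n))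
    (W : Submodule ℝ (EuclideanSpace ℝ (Fin n))) : Prop :=
  IsInvariant H W ∧ W ≠ ⊥ ∧
    ∀ V : Submodule ℝ (EuclideanSpace ℝ (Fin n)), V ≤ W → IsInvariant H V → V = ⊥ ∨ V = W

/-- Let `F` be a set of real matrices with rows and columns indexed by `ι`. `HasFactor H F` says
that `H` has an irreducible factor conjugate to `F`: there is an irreducible subspace `W` of `ℝⁿ`
under `H × C_{O(n)}(H)` such that the restriction of `H` to `W` becomes `F` under some linear
isometry of `ℝ^ι` onto `W`. -/
def HasFactor {n : ℕ} (H : Subgroup (O n)) {ι : Type} [Fintype ι] [DecidableEq ι]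
    (F : Set (Matrix ι ι ℝ)) : Prop :=
  ∃ W : Submodule ℝ (EuclideanSpace ℝ (Fin n)), IsIrreducibleSubspace H W ∧
    ∃ e : EuclideanSpace ℝ ι ≃ₗᵢ[ℝ] W,
      {B : Matrix ι ι ℝ | ∃ h ∈ H, ∀ x : EuclideanSpace ℝ ι,
        act h (e x : EuclideanSpace ℝ (Fin n)) = (e (Matrix.toEuclideanLin B x) : W)} = F

/-- The standard irreducible Howe subgroup `O(m)_k` with base field `ℝ`, rank `m` and
multiplicity `k`: the matrices `a ⊗ 1_k` with `a ∈ O(m)`. -/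
def stdO (m k : ℕ) : Set (Matrix (Fin m × Fin k) (Fin m × Fin k) ℝ) :=
  {B | ∃ a ∈ Matrix.orthogonalGroup (Fin m) ℝ, B = a ⊗ₖ (1 : Matrix (Fin k) (Fin k) ℝ)}

/-- Field restriction `M_ℂ(m) → M_ℝ(2m)`, sending `a₁ + i a₂` to the block matrix
`[a₁, a₂; -a₂, a₁]`. -/
def fieldRestriction {m : ℕ} (a : Matrix (Fin m) (Fin m) ℂ) :
    Matrix (Fin m ⊕ Fin m) (Fin m ⊕ Fin m) ℝ :=
  Matrix.fromBlocks (a.map Complex.re) (a.map Complex.im) (-a.map Complex.im) (a.map Complex.re)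

/-- The standard irreducible Howe subgroup `U(m)_k` with base field `ℂ`, rank `m` and
multiplicity `k`: the matrices `φ(a) ⊗ 1_k` with `a ∈ U(m)` and `φ` the field restriction. -/
def stdU (m k : ℕ) : Set (Matrix ((Fin m ⊕ Fin m) × Fin k) ((Fin m ⊕ Fin m) × Fin k) ℝ) :=
  {B | ∃ a ∈ Matrix.unitaryGroup (Fin m) ℂ,
    B = fieldRestriction a ⊗ₖ (1 : Matrix (Fin k) (Fin k) ℝ)}

/-- `H` contains an `O`-factor of rank `m` and multiplicity `k`. -/
def HasOFactor {n : ℕ} (H : Subgroup (O n)) (m k : ℕ) : Prop := HasFactor H (stdO m k)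

/-- `H` contains a `U`-factor of rank `m` and multiplicity `k`. -/
def HasUFactor {n : ℕ} (H : Subgroup (O n)) (m k : ℕ) : Prop := HasFactor H (stdU m k)

/-- The set of `SO(n)`-conjugacy classes to which the `O(n)`-conjugacy class of `H` gives rise on
intersection with `SO(n)`: the classes of the subgroups `S H'`, where `H'` runs through the
`O(n)`-conjugacy class of `H`. -/
def inducedClasses {n : ℕ} (H : Subgroup (O n)) : Set (Set (Subgroup (SO n))) :=
  {C | ∃ H' ∈ conjClass H, C = conjClass (S H')}

/-- `H` contains an `O`-factor of odd rank or odd multiplicity, or a `U`-factor of odd rank and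
odd multiplicity. -/
def HasOddFactor {n : ℕ} (H : Subgroup (O n)) : Prop :=
  (∃ m k : ℕ, HasOFactor H m k ∧ (Odd m ∨ Odd k)) ∨
    (∃ m k : ℕ, HasUFactor H m k ∧ Odd m ∧ Odd k)

end Howe

/-! ### Dual pairs of operator algebras on a Euclidean space. -/

namespace RealDualPair

open scoped InnerProductSpace
open Module

variable {E : Type*} [NormedAddCommGroup E] [InnerProductSpace ℝ E] [FiniteDimensional ℝ E]

/-! Since `SO(n)` has index two in `O(n)`, at most two classes arise, those of `S H` and of `S (conj
a H)` with `det a = -1`. Admissibility makes `H` the double centralizer of `S H` in `O(n)`, so `S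
(conj g H) = S H` forces `conj g H = H`. Hence there is one class exactly when some `g` of
determinant -1 normalizes `H` (`conjClass_eq_iff`). The remaining question concerns the normalizer
of `H`.

Let `B` be the commutant of `H` and `A` that of its centralizer. A commutant of a star-closed set is
governed by its orthogonal elements (reflections and Cayley transforms), so `A` and `B` are each
other's commutant, and `H` consists of the orthogonal elements of `A` (`isDualPair`,
`mem_of_act_mem_leftAlg`). On an irreducible subspace `W` the restricted pair is a factor: symmetric
central elements are scalars.

An odd factor provides `g` directly: `1 ⊗ D` or `D ⊗ 1` with a reflection `D`, or complex
conjugation tensored with the identity, extended by the identity off `W`. The determinants are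
`(-1)^m`, `(-1)^k` and `(-1)^(mk)`.

Conversely, let `c` normalize `A` with determinant -1. If all irreducible subspaces have even
dimension, modifying `c` by swaps of determinant 1 reduces to the case where `c` preserves some `W`
and has determinant -1 there; an odd-dimensional `W` is handled by -1 (`exists_irr_hasOddType`). On
a factor (`hasOddType`), suppose first that the center is trivial. Then `c = x * y` with orthogonal
`x ∈ A` and `y ∈ B`, as in the Skolem–Noether theorem. Either one of the algebras is of real type,
where `det x = (det a)^k` and `det y = (det b)^m`, or both contain complex structures. In the latter
case `x` and `y` are complex linear and have nonnegative determinant, which is absurd; thus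
quaternionic factors need no classification. If the center is nontrivial, it contains a complex
structure `J`. Then `c` must anticommute with `J`, and comparison with complex conjugation, of
determinant `(-1)^(mk)`, makes `m` and `k` odd. -/

theorem inner_star_left (T : End ℝ E) (x y : E) : ⟪star T x, y⟫_ℝ = ⟪x, T y⟫_ℝ :=
  LinearMap.adjoint_inner_left T y x

theorem inner_star_right (T : End ℝ E) (x y : E) : ⟪x, star T y⟫_ℝ = ⟪T x, y⟫_ℝ :=
  LinearMap.adjoint_inner_right T x y

theorem eq_star_iff (S T : End ℝ E) : S = star T ↔ ∀ x y, ⟪S x, y⟫_ℝ = ⟪x, T y⟫_ℝ :=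
  LinearMap.eq_adjoint_iff S T

theorem isSymmetric_of_star_eq {s : End ℝ E} (hs : star s = s) : s.IsSymmetric := fun x y => by
  rw [← inner_star_right, hs]

theorem star_mul_self_eq_zero {T : End ℝ E} (h : star T * T = 0) : T = 0 := by
  ext x
  have : ⟪T x, T x⟫_ℝ = 0 := by
    rw [← inner_star_right, ← Module.End.mul_apply, h]
    simp
  simpa using this

theorem mul_star_eq_one {c : End ℝ E} (hc : star c * c = 1) : c * star c = 1 :=
  mul_eq_one_comm.mp hc

theorem det_star (T : End ℝ E) : LinearMap.det (star T) = LinearMap.det T := by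
  let b := stdOrthonormalBasis ℝ E
  rw [← LinearMap.det_toMatrix b.toBasis (star T), ← LinearMap.det_toMatrix b.toBasis T]
  have h := LinearMap.toMatrix_adjoint b b T
  rw [LinearMap.star_eq_adjoint, h]
  simp

theorem det_eq_one_or_neg_one {c : End ℝ E} (hc : star c * c = 1) :
    LinearMap.det c = 1 ∨ LinearMap.det c = -1 := by
  have h := congrArg LinearMap.det hc
  rw [map_mul, det_star, map_one] at h
  exact mul_self_eq_one_iff.mp h

/-! ### Orthogonal projections -/

/-- The orthogonal projection onto a subspace, as an endomorphism. -/
noncomputable def proj (V : Submodule ℝ E) : End ℝ E := (V.starProjection : E →L[ℝ] E).toLinearMap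

theorem proj_mem (V : Submodule ℝ E) (x : E) : proj V x ∈ V := V.starProjection_apply_mem x

theorem proj_apply_of_mem {V : Submodule ℝ E} {x : E} (hx : x ∈ V) : proj V x = x :=
  Submodule.starProjection_eq_self_iff.mpr hx

theorem star_proj (V : Submodule ℝ E) : star (proj V) = proj V := by
  refine ((eq_star_iff _ _).mpr fun x y => ?_).symm
  exact V.inner_starProjection_left_eq_right x y

theorem proj_mul_proj (V : Submodule ℝ E) : proj V * proj V = proj V :=
  LinearMap.ext fun x => proj_apply_of_mem (proj_mem V x)

theorem proj_ne_zero {V : Submodule ℝ E} (hV : V ≠ ⊥) : proj V ≠ 0 := by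
  intro h
  refine hV ((Submodule.eq_bot_iff _).mpr fun x hx => ?_)
  rw [← proj_apply_of_mem hx, h, LinearMap.zero_apply]

theorem proj_mul_eq_of_maps {T : End ℝ E} {V : Submodule ℝ E} (h : ∀ x, T x ∈ V) :
    proj V * T = T :=
  LinearMap.ext fun x => proj_apply_of_mem (h x)

theorem mul_proj_eq_proj_mul {T : End ℝ E} {V : Submodule ℝ E} (h₁ : ∀ x ∈ V, T x ∈ V)
    (h₂ : ∀ x ∈ V, star T x ∈ V) : T * proj V = proj V * T := by
  have key : ∀ S : End ℝ E, (∀ x ∈ V, S x ∈ V) → S * proj V = proj V * (S * proj V) := fun S hS =>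
    (proj_mul_eq_of_maps fun x => hS _ (proj_mem V x) :
      proj V * (S * proj V) = S * proj V).symm
  have k := congrArg star (key _ h₂)
  simp only [star_mul, star_star, star_proj] at k
  rw [key T h₁, k, mul_assoc]

theorem mem_of_mul_proj_eq {T : End ℝ E} {V : Submodule ℝ E} (h : T * proj V = proj V * T) {x : E}
    (hx : x ∈ V) : T x ∈ V := by
  rw [← proj_apply_of_mem hx, ← Module.End.mul_apply, h]
  exact proj_mem V _

/-! ### Irreducible subspaces -/

/-- `V` is stable under the set `S` of endomorphisms. -/
def Stable (S : Set (End ℝ E)) (V : Submodule ℝ E) : Prop := ∀ T ∈ S, ∀ x ∈ V, T x ∈ V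

/-- `V` is a minimal nonzero `S`-stable subspace. -/
def Irr (S : Set (End ℝ E)) (V : Submodule ℝ E) : Prop :=
  Stable S V ∧ V ≠ ⊥ ∧ ∀ U ≤ V, Stable S U → U = ⊥ ∨ U = V

theorem exists_irr_le {S : Set (End ℝ E)} {V : Submodule ℝ E} (hV : Stable S V) (h0 : V ≠ ⊥) :
    ∃ U ≤ V, Irr S U := by
  obtain ⟨U, ⟨hUV, hU, hU0⟩, hmin⟩ :=
    (wellFounded_lt (α := Submodule ℝ E)).has_min {U | U ≤ V ∧ Stable S U ∧ U ≠ ⊥}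
      ⟨V, le_rfl, hV, h0⟩
  refine ⟨U, hUV, hU, hU0, fun W hWU hW => ?_⟩
  by_contra! h
  exact hmin W ⟨hWU.trans hUV, hW, h.1⟩ (lt_of_le_of_ne hWU h.2)

theorem Stable.inf {S : Set (End ℝ E)} {U V : Submodule ℝ E} (hU : Stable S U) (hV : Stable S V) :
    Stable S (U ⊓ V) := fun T hT x hx => ⟨hU T hT x hx.1, hV T hT x hx.2⟩

/-- Schur's lemma for symmetric operators. -/
theorem Irr.exists_scalar {S : Set (End ℝ E)} {V : Submodule ℝ E} (hV : Irr S V) {s : End ℝ E}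
    (hs : star s = s) (hc : ∀ T ∈ S, T * s = s * T) (hsV : ∀ x ∈ V, s x ∈ V) :
    ∃ μ : ℝ, ∀ x ∈ V, s x = μ • x := by
  have hsym : (s.restrict hsV).IsSymmetric := fun x y => isSymmetric_of_star_eq hs x y
  have hnt : Nontrivial V := Submodule.nontrivial_iff_ne_bot.mpr hV.2.1
  -- A symmetric operator on a nonzero space has a real eigenvalue, because its eigenspaces span.
  have hev : ∃ μ : ℝ, End.eigenspace (s.restrict hsV) μ ≠ ⊥ := by
    by_contra! h
    have h1 := hsym.orthogonalComplement_iSup_eigenspaces_eq_bot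
    have h2 : (⨆ μ, End.eigenspace (s.restrict hsV) μ) = ⊥ := by simp [h]
    rw [h2, Submodule.bot_orthogonal_eq_top] at h1
    exact bot_ne_top h1.symm
  obtain ⟨μ, hμ⟩ := hev
  obtain ⟨⟨x, hxV⟩, hx, hx0⟩ := Submodule.exists_mem_ne_zero_of_ne_bot hμ
  have hx' : s x = μ • x := by
    have := End.mem_eigenspace_iff.mp hx
    exact congrArg Subtype.val this
  refine ⟨μ, ?_⟩
  have hst : Stable S (V ⊓ End.eigenspace s μ) := by
    rintro T hT y ⟨hy, hy'⟩
    refine ⟨hV.1 T hT y hy, ?_⟩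
    have hy' : s y = μ • y := End.mem_eigenspace_iff.mp hy'
    refine End.mem_eigenspace_iff.mpr ?_
    rw [← Module.End.mul_apply, ← hc T hT, Module.End.mul_apply, hy', map_smul]
  rcases hV.2.2 _ inf_le_left hst with h | h
  · exfalso
    have : x ∈ V ⊓ End.eigenspace s μ := ⟨hxV, End.mem_eigenspace_iff.mpr hx'⟩
    rw [h, Submodule.mem_bot] at this
    exact hx0 (Subtype.ext this)
  · intro y hy
    rw [← h] at hy
    exact End.mem_eigenspace_iff.mp hy.2

/-! ### Complex structures -/

/-- `J` turns the space into a complex vector space on which `T` is complex linear, and the real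
determinant is the squared modulus of the complex one. -/
theorem det_nonneg_of_commute {J T : End ℝ E} (hJ : J * J = -1) (hT : T * J = J * T) :
    0 ≤ LinearMap.det T := by
  let φ : ℂ →ₐ[ℝ] End ℝ E := Complex.lift ⟨J, hJ⟩
  let _ : Module ℂ E := Module.compHom E φ.toRingHom
  have hsm : ∀ (z : ℂ) (x : E), z • x = z.re • x + z.im • J x := fun z x => by
    change φ z x = _
    simp [φ, Complex.lift_apply, Complex.liftAux_apply]
  have _ : IsScalarTower ℝ ℂ E := ⟨fun r z x => by
    simp [hsm, mul_smul, smul_add]⟩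
  have _ : Module.Finite ℂ E := Module.Finite.of_restrictScalars_finite ℝ ℂ E
  let T' : E →ₗ[ℂ] E :=
    { toFun := T
      map_add' := map_add T
      map_smul' := fun z x => by
        have := congrArg (fun f : End ℝ E => f x) hT
        simp only [Module.End.mul_apply] at this
        simp [hsm, this] }
  have h : T'.restrictScalars ℝ = T := rfl
  rw [← h, LinearMap.det_restrictScalars, Algebra.norm_complex_apply]
  exact Complex.normSq_nonneg _

/-! ### Endomorphism algebras are generated by orthogonal elements -/

/-- If `x = K x`, then `⟪x, x⟫ = ⟪x, K x⟫ = 0` by skewness. This makes the Cayley transform of `K`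
available. -/
theorem isUnit_one_sub_of_skew {K : End ℝ E} (hK : star K = -K) : IsUnit (1 - K) := by
  rw [LinearMap.isUnit_iff_ker_eq_bot, LinearMap.ker_eq_bot']
  intro x hx
  have hx : x = K x := by simpa [sub_eq_zero] using hx
  have h : ⟪x, K x⟫_ℝ = -⟪x, K x⟫_ℝ := by
    conv_lhs => rw [← inner_star_left, hK]
    simp [real_inner_comm]
  have h2 : ⟪x, x⟫_ℝ = 0 := by
    conv_lhs => rw [hx]
    rw [← hx]
    nth_rewrite 2 [hx]
    linarith
  simpa using h2

/-- The spectral projections of `b` lie in `B`, and each is an affine function of a reflection in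
`B`. So `X` preserves every eigenspace of `b`, and these span. -/
theorem commute_of_commute_orthogonal_sym {B : Subalgebra ℝ (End ℝ E)} {S : Set (End ℝ E)}
    (hS : ∀ T ∈ S, star T ∈ S) (hB : ∀ T, T ∈ B ↔ ∀ s ∈ S, s * T = T * s) {X : End ℝ E}
    (hX : ∀ b ∈ B, star b * b = 1 → b * X = X * b) {b : End ℝ E} (hb : b ∈ B) (hs : star b = b) :
    b * X = X * b := by
  have hsym := isSymmetric_of_star_eq hs
  have hcomm : ∀ μ : ℝ, X * proj (End.eigenspace b μ) = proj (End.eigenspace b μ) * X := by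
    intro μ
    have hp : proj (End.eigenspace b μ) ∈ B := by
      refine (hB _).mpr fun s hsS => ?_
      have aux : ∀ s ∈ S, ∀ x ∈ End.eigenspace b μ, s x ∈ End.eigenspace b μ := by
        intro s hs x hx
        rw [End.mem_eigenspace_iff] at hx ⊢
        rw [← Module.End.mul_apply, ← (hB b).mp hb s hs, Module.End.mul_apply, hx, map_smul]
      exact mul_proj_eq_proj_mul (aux s hsS) (aux _ (hS s hsS))
    -- The reflection in the orthogonal complement of the eigenspace is an orthogonal element of
    -- `B`.
    have hr := hX (1 - (2 : ℝ) • proj (End.eigenspace b μ))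
      (B.sub_mem B.one_mem (B.smul_mem hp _)) (by
        rw [star_sub, star_smul, star_proj, star_one]
        simp [sub_mul, mul_sub, proj_mul_proj]
        module)
    simp only [sub_mul, mul_sub, one_mul, mul_one, sub_right_inj, smul_mul_assoc,
      mul_smul_comm] at hr
    exact (smul_right_injective _ (two_ne_zero' ℝ) hr).symm
  have htop : (⨆ μ, End.eigenspace b μ) = ⊤ := by
    have := hsym.orthogonalComplement_iSup_eigenspaces_eq_bot
    rwa [Submodule.orthogonal_eq_bot_iff] at this
  ext x
  have hx : x ∈ ⨆ μ, End.eigenspace b μ := htop ▸ Submodule.mem_top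
  induction hx using Submodule.iSup_induction' with
  | mem μ x hx =>
    have h2 := mem_of_mul_proj_eq (hcomm μ) hx
    rw [End.mem_eigenspace_iff] at hx h2
    rw [Module.End.mul_apply, Module.End.mul_apply, h2, hx, map_smul]
  | zero => simp
  | add x y _ _ hx hy => rw [map_add, map_add, hx, hy]

/-- An operator commuting with the orthogonal elements of a commutant `B` of a star-closed set
commutes with all of `B`. -/
theorem commute_of_commute_orthogonal {B : Subalgebra ℝ (End ℝ E)} {S : Set (End ℝ E)}
    (hS : ∀ T ∈ S, star T ∈ S) (hB : ∀ T, T ∈ B ↔ ∀ s ∈ S, s * T = T * s) {X : End ℝ E}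
    (hX : ∀ b ∈ B, star b * b = 1 → b * X = X * b) {b : End ℝ E} (hb : b ∈ B) :
    b * X = X * b := by
  have hstar : ∀ T ∈ B, star T ∈ B := fun T hT => (hB _).mpr fun s hs => by
    have := congrArg star ((hB T).mp hT _ (hS s hs))
    simpa using this.symm
  -- With `u = 1 - K`, the Cayley transform `u⁻¹ (1 + K) = 2 u⁻¹ - 1` is orthogonal and lies in `B`.
  -- Commuting with it means commuting with `u⁻¹`, hence with `K`.
  have hskew : ∀ K ∈ B, star K = -K → K * X = X * K := by
    intro K hK hKs
    obtain ⟨u, hu⟩ := isUnit_one_sub_of_skew hKs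
    have hplus : (1 + K) = star (u : End ℝ E) := by rw [hu]; simp [hKs]
    have hcomm : star (u : End ℝ E) * u = u * star (u : End ℝ E) := by
      rw [← hplus, hu]; noncomm_ring
    have hinv : (↑u⁻¹ : End ℝ E) ∈ B := by
      refine (hB _).mpr fun s hs => ?_
      have h1 : s * (u : End ℝ E) = u * s := by
        rw [hu, mul_sub, sub_mul, (hB K).mp hK s hs, mul_one, one_mul]
      exact (Commute.units_inv_right (h1 : Commute s u))
    have hinvc : star (↑u⁻¹ : End ℝ E) * star (u : End ℝ E) = 1 := by
      rw [← star_mul, Units.mul_inv, star_one]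
    have hU : (2 : ℝ) • (↑u⁻¹ : End ℝ E) - 1 = ↑u⁻¹ * star (u : End ℝ E) := by
      have h2 : star (u : End ℝ E) = (2 : ℝ) • (1 : End ℝ E) - u := by
        rw [← hplus, hu]; module
      rw [h2, mul_sub, Units.inv_mul, mul_smul_comm, mul_one]
    have horth : star ((2 : ℝ) • (↑u⁻¹ : End ℝ E) - 1) * ((2 : ℝ) • (↑u⁻¹ : End ℝ E) - 1) = 1 := by
      rw [hU, star_mul, star_star]
      have h3 : (↑u⁻¹ : End ℝ E) * star (u : End ℝ E) = star (u : End ℝ E) * ↑u⁻¹ :=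
        ((Commute.units_inv_right (hcomm : Commute (star (u : End ℝ E)) u))).symm
      rw [h3, mul_assoc, ← mul_assoc (star (↑u⁻¹ : End ℝ E)), hinvc, one_mul, Units.mul_inv]
    have h4 := hX _ (B.sub_mem (B.smul_mem hinv 2) B.one_mem) horth
    simp only [sub_mul, mul_sub, one_mul, mul_one, sub_left_inj, smul_mul_assoc,
      mul_smul_comm] at h4
    have h5 : Commute X (↑u⁻¹ : End ℝ E) := (smul_right_injective _ (two_ne_zero' ℝ) h4).symm
    have h6 : X * (u : End ℝ E) = u * X := by
      have h7 := h5.units_inv_right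
      rwa [inv_inv] at h7
    rw [hu, mul_sub, sub_mul, mul_one, one_mul, sub_right_inj] at h6
    exact h6.symm
  have h1 := commute_of_commute_orthogonal_sym hS hB hX (b := b + star b)
    (B.add_mem hb (hstar b hb)) (by simp [add_comm])
  have h2 := hskew (b - star b) (B.sub_mem hb (hstar b hb)) (by simp)
  have h3 : (2 : ℝ) • b = (b + star b) + (b - star b) := by module
  have h4 : ((2 : ℝ) • b) * X = X * ((2 : ℝ) • b) := by rw [h3, add_mul, mul_add, h1, h2]
  rw [smul_mul_assoc, mul_smul_comm] at h4
  exact smul_right_injective _ (two_ne_zero' ℝ) h4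

/-! ### Dual pairs -/

/-- Two star-closed algebras of endomorphisms which are each other's commutant. -/
structure IsDualPair (A B : Subalgebra ℝ (End ℝ E)) : Prop where
  mem_left : ∀ T, T ∈ A ↔ ∀ b ∈ B, T * b = b * T
  mem_right : ∀ T, T ∈ B ↔ ∀ a ∈ A, a * T = T * a
  star_left : ∀ T ∈ A, star T ∈ A
  star_right : ∀ T ∈ B, star T ∈ B

namespace IsDualPair

variable {A B : Subalgebra ℝ (End ℝ E)}

theorem symm (h : IsDualPair A B) : IsDualPair B A where
  mem_left T := (h.mem_right T).trans (by simp only [eq_comm])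
  mem_right T := (h.mem_left T).trans (by simp only [eq_comm])
  star_left := h.star_right
  star_right := h.star_left

theorem comm (h : IsDualPair A B) {a b : End ℝ E} (ha : a ∈ A) (hb : b ∈ B) : a * b = b * a :=
  (h.mem_left a).mp ha b hb

theorem proj_mem_left (h : IsDualPair A B) {V : Submodule ℝ E} (hV : Stable (B : Set (End ℝ E)) V) :
    proj V ∈ A :=
  (h.mem_left _).mpr fun b hb =>
    (mul_proj_eq_proj_mul (hV b hb) (hV _ (h.star_right b hb))).symm

theorem conj_mem_right (h : IsDualPair A B) {c : End ℝ E} (hc : star c * c = 1)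
    (hcA : ∀ T, T ∈ A ↔ c * T * star c ∈ A) (T : End ℝ E) : T ∈ B ↔ c * T * star c ∈ B := by
  have hc' := mul_star_eq_one hc
  have e1 : ∀ X Y : End ℝ E, (c * X * star c) * (c * Y * star c) = c * (X * Y) * star c := by
    intro X Y
    calc _ = c * X * (star c * c) * Y * star c := by noncomm_ring
      _ = _ := by rw [hc]; noncomm_ring
  have e2 : ∀ X Y : End ℝ E, c * X * star c = c * Y * star c → X = Y := by
    intro X Y hXY
    have : star c * (c * X * star c) * c = star c * (c * Y * star c) * c := by rw [hXY]
    have e3 : ∀ Z, star c * (c * Z * star c) * c = Z := fun Z => by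
      calc _ = (star c * c) * Z * (star c * c) := by noncomm_ring
        _ = Z := by rw [hc]; simp
    rwa [e3, e3] at this
  have e4 : ∀ Z, c * (star c * Z * c) * star c = Z := fun Z => by
    calc _ = (c * star c) * Z * (c * star c) := by noncomm_ring
      _ = Z := by rw [hc']; simp
  rw [h.mem_right, h.mem_right]
  constructor
  · intro hT a ha
    have ha' : star c * a * c ∈ A := (hcA _).mpr (by rwa [e4])
    have := hT _ ha'
    rw [← e4 a, e1, e1, this]
  · intro hT a ha
    have := hT _ ((hcA a).mp ha)
    rw [e1, e1] at this
    exact e2 _ _ this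

end IsDualPair

/-! ### Factors and frames of partial isometries. -/

theorem exists_last {P : ℕ → Prop} (h0 : P 0) {N : ℕ} (hN : ¬ P N) : ∃ m, P m ∧ ¬ P (m + 1) := by
  by_contra! h
  exact hN (Nat.rec h0 (fun m hm => h m hm) N)

/-- The symmetric part of the center of a dual pair consists of scalars. -/
def IsFactor (A B : Subalgebra ℝ (End ℝ E)) : Prop :=
  ∀ z ∈ A, z ∈ B → star z = z → ∃ μ : ℝ, z = μ • 1

theorem IsFactor.symm {A B : Subalgebra ℝ (End ℝ E)} (h : IsFactor A B) : IsFactor B A :=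
  fun z hB hA hz => h z hA hB hz

/-- A family of partial isometries from `V` onto mutually orthogonal subspaces which span `E`. -/
structure IsFrame (V : Submodule ℝ E) {m : ℕ} (f : Fin m → End ℝ E) : Prop where
  mul_proj : ∀ i, f i * proj V = f i
  star_mul : ∀ i j, star (f i) * f j = if i = j then proj V else 0
  sum : ∑ i, f i * star (f i) = 1

namespace IsDualPair

variable {A B : Subalgebra ℝ (End ℝ E)}

/-- Schur's lemma for the corner algebra of an irreducible subspace. -/
theorem exists_scalar (h : IsDualPair A B) {V : Submodule ℝ E} (hV : Irr (B : Set (End ℝ E)) V)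
    {s : End ℝ E} (hs : s ∈ A) (hst : star s = s) (hps : proj V * s = s) :
    ∃ μ : ℝ, s = μ • proj V := by
  have hsp : s * proj V = s := by
    have := congrArg star hps
    rwa [star_mul, hst, star_proj] at this
  have hmaps : ∀ x ∈ V, s x ∈ V := fun x _ => by
    rw [← hps]; exact proj_mem V _
  obtain ⟨μ, hμ⟩ := hV.exists_scalar hst (fun T hT => (h.comm hs hT).symm) hmaps
  refine ⟨μ, LinearMap.ext fun x => ?_⟩
  rw [← hsp]
  exact hμ _ (proj_mem V x)

/-- Take a maximal family in `A` of isometries of `V` onto orthogonal subspaces. By maximality the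
projection `P₀` onto the sum of the ranges absorbs every `g ∈ A` supported on `V`. Then `P₀`
commutes with `A`, so it is a symmetric central element, that is, a scalar, and this scalar is 1
because `P₀` fixes `V`. -/
theorem exists_frame (h : IsDualPair A B) (hZ : IsFactor A B) {V : Submodule ℝ E}
    (hV : Irr (B : Set (End ℝ E)) V) :
    ∃ (m : ℕ) (f : Fin m → End ℝ E), (∀ i, f i ∈ A) ∧ IsFrame V f := by
  have hpA := h.proj_mem_left hV.1
  obtain ⟨v, hv, hv0⟩ := Submodule.exists_mem_ne_zero_of_ne_bot hV.2.1
  let P : ℕ → Prop := fun m => ∃ f : Fin m → End ℝ E, (∀ i, f i ∈ A) ∧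
    (∀ i, f i * proj V = f i) ∧ ∀ i j, star (f i) * f j = if i = j then proj V else 0
  have h0 : P 0 := ⟨Fin.elim0, fun i => i.elim0, fun i => i.elim0, fun i => i.elim0⟩
  -- The images of one nonzero `v ∈ V` are orthogonal and nonzero, which bounds the size of the
  -- family.
  have hN : ¬ P (finrank ℝ E + 1) := by
    rintro ⟨f, -, -, hf⟩
    have hli : LinearIndependent ℝ (fun i => f i v) := by
      refine linearIndependent_of_ne_zero_of_inner_eq_zero (fun i hi => hv0 ?_) fun i j hij => ?_
      · have := congrArg (fun T : End ℝ E => T v) (hf i i)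
        simp only [Module.End.mul_apply, hi, map_zero, if_true] at this
        rw [← proj_apply_of_mem hv, ← this]
      · change ⟪f i v, f j v⟫_ℝ = 0
        rw [← inner_star_right, ← Module.End.mul_apply, hf, if_neg hij]
        simp
    have := hli.fintype_card_le_finrank
    simp at this
  obtain ⟨m, ⟨f, hfA, hfp, hff⟩, hm⟩ := exists_last h0 hN
  refine ⟨m, f, hfA, hfp, hff, ?_⟩
  set P₀ := ∑ i, f i * star (f i) with hP₀
  have hpf : ∀ i, proj V * star (f i) = star (f i) := fun i => by
    have := congrArg star (hfp i)
    rwa [star_mul, star_proj] at this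
  have hfP : ∀ j, star (f j) * P₀ = star (f j) := by
    intro j
    simp only [hP₀, Finset.mul_sum, ← mul_assoc, hff]
    simp [hpf]
  have hP₀A : P₀ ∈ A := A.sum_mem fun i _ => A.mul_mem (hfA i) (h.star_left _ (hfA i))
  have hP₀s : star P₀ = P₀ := by simp [hP₀, star_sum]
  -- Otherwise the remainder `g'` is orthogonal to all ranges, and `star g' * g'` is a positive
  -- multiple `μ` of `proj V` by Schur's lemma. Dividing `g'` by `√μ` gives one more member of the
  -- family.
  have hcover : ∀ g ∈ A, g * proj V = g → P₀ * g = g := by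
    intro g hg hgp
    by_contra hne
    set g' := g - P₀ * g with hg'
    have hg'A : g' ∈ A := A.sub_mem hg (A.mul_mem hP₀A hg)
    have hg'0 : g' ≠ 0 := fun h => hne (sub_eq_zero.mp h).symm
    have hg'p : g' * proj V = g' := by rw [hg', sub_mul, mul_assoc, hgp]
    have hpg' : proj V * star g' = star g' := by
      have := congrArg star hg'p
      rwa [star_mul, star_proj] at this
    have hfg : ∀ j, star (f j) * g' = 0 := fun j => by
      rw [hg', mul_sub, ← mul_assoc, hfP, sub_self]
    have hgf : ∀ j, star g' * f j = 0 := fun j => by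
      have := congrArg star (hfg j)
      simpa using this
    obtain ⟨μ, hμ⟩ := h.exists_scalar hV (s := star g' * g') (A.mul_mem (h.star_left _ hg'A) hg'A)
      (by simp) (by rw [← mul_assoc, hpg'])
    have hμ0 : μ ≠ 0 := by
      rintro rfl
      exact hg'0 (star_mul_self_eq_zero (by simpa using hμ))
    have hμpos : 0 < μ := by
      refine lt_of_le_of_ne ?_ hμ0.symm
      have h1 : ⟪v, (star g' * g') v⟫_ℝ = μ * ⟪v, v⟫_ℝ := by
        rw [hμ, LinearMap.smul_apply, proj_apply_of_mem hv, real_inner_smul_right]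
      rw [Module.End.mul_apply, inner_star_right] at h1
      have h2 : 0 < ⟪v, v⟫_ℝ := real_inner_self_pos.mpr hv0
      have h3 : 0 ≤ ⟪g' v, g' v⟫_ℝ := real_inner_self_nonneg
      rw [h1] at h3
      exact nonneg_of_mul_nonneg_left h3 h2
    refine hm ⟨Fin.snoc f ((√μ)⁻¹ • g'), fun i => ?_, fun i => ?_, fun i j => ?_⟩
    · induction i using Fin.lastCases with
      | last => simpa using A.smul_mem hg'A _
      | cast i => simpa using hfA i
    · induction i using Fin.lastCases with
      | last => simp [hg'p]
      | cast i => simpa using hfp i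
    · induction i using Fin.lastCases with
      | last =>
        induction j using Fin.lastCases with
        | last =>
          have : (√μ)⁻¹ * ((√μ)⁻¹ * μ) = 1 := by
            have h5 : √μ ≠ 0 := (Real.sqrt_pos.mpr hμpos).ne'
            field_simp
            exact (Real.sq_sqrt hμpos.le).symm
          simp [hμ, smul_smul, this]
        | cast j => simp [hgf, (Fin.castSucc_lt_last j).ne']
      | cast i =>
        induction j using Fin.lastCases with
        | last => simp [hfg, (Fin.castSucc_lt_last i).ne]
        | cast j => simpa using hff i j
  have hPaP : ∀ a ∈ A, P₀ * (a * P₀) = a * P₀ := by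
    intro a ha
    rw [hP₀, Finset.mul_sum, Finset.mul_sum, ← hP₀]
    refine Finset.sum_congr rfl fun i _ => ?_
    rw [← mul_assoc a, ← mul_assoc P₀,
      hcover _ (A.mul_mem ha (hfA i)) (by rw [mul_assoc, hfp])]
  -- The range of `P₀` is stable under `A`; as `A` is star-closed, adjoints turn `a P₀ = P₀ a P₀`
  -- into `P₀ a = P₀ a P₀`.
  have hP₀B : P₀ ∈ B := by
    refine (h.mem_right _).mpr fun a ha => ?_
    have := congrArg star (hPaP _ (h.star_left a ha))
    simp only [star_mul, star_star, hP₀s] at this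
    rw [← hPaP a ha, ← this, mul_assoc]
  obtain ⟨μ, hμ⟩ := hZ P₀ hP₀A hP₀B hP₀s
  have h1 : P₀ * proj V = proj V := hcover _ hpA (proj_mul_proj V)
  have h2 : (μ - 1) • proj V = 0 := by
    rw [hμ, smul_mul_assoc, one_mul] at h1
    rw [sub_smul, h1, one_smul, sub_self]
  rcases smul_eq_zero.mp h2 with h3 | h3
  · rw [hμ, sub_eq_zero.mp h3, one_smul]
  · exact absurd h3 (proj_ne_zero hV.2.1)

end IsDualPair

namespace IsFrame

variable {V : Submodule ℝ E} {m : ℕ} {f : Fin m → End ℝ E}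

theorem proj_mul_star (hf : IsFrame V f) (i : Fin m) : proj V * star (f i) = star (f i) := by
  have := congrArg star (hf.mul_proj i)
  rwa [StarMul.star_mul, star_proj] at this

theorem star_apply_mem (hf : IsFrame V f) (i : Fin m) (x : E) : star (f i) x ∈ V := by
  rw [← hf.proj_mul_star]; exact proj_mem V _

theorem eq_zero (hf : IsFrame V f) {x : E} (hx : ∀ i, star (f i) x = 0) : x = 0 := by
  have := congrArg (fun T : End ℝ E => T x) hf.sum
  simp only [LinearMap.sum_apply, Module.End.mul_apply, hx, map_zero, Finset.sum_const_zero,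
    Module.End.one_apply] at this
  exact this.symm

theorem inner_mul_apply (f : Fin m → End ℝ E) (T : End ℝ E) (i j : Fin m) (x y : E) :
    ⟪f i x, T (f j y)⟫_ℝ = ⟪x, (star (f i) * T * f j) y⟫_ℝ := by
  rw [Module.End.mul_apply, Module.End.mul_apply, inner_star_right]

/-- The orthonormal basis obtained by moving an orthonormal basis of `V` by the frame. -/
theorem exists_basis (hf : IsFrame V f) : ∃ (k : ℕ) (v : OrthonormalBasis (Fin k) ℝ V)
    (w : OrthonormalBasis (Fin m × Fin k) ℝ E), ∀ i l, w (i, l) = f i (v l) := by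
  let v := stdOrthonormalBasis ℝ V
  let w₀ : Fin m × Fin (finrank ℝ V) → E := fun a => f a.1 (v a.2)
  have hw : Orthonormal ℝ w₀ := by
    rw [orthonormal_iff_ite]
    rintro ⟨i, l⟩ ⟨j, l'⟩
    have := inner_mul_apply f 1 i j (v l) (v l')
    simp only [Module.End.one_apply, mul_one, hf.star_mul] at this
    simp only [w₀, this]
    have hv := orthonormal_iff_ite.mp v.orthonormal l l'
    by_cases hij : i = j
    · simp only [hij, if_true, proj_apply_of_mem (v l').2, Prod.mk.injEq, true_and]
      exact hv
    · simp [hij]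
  refine ⟨_, v, OrthonormalBasis.mkOfOrthogonalEqBot hw ?_, fun i l => by
    rw [OrthonormalBasis.coe_of_orthogonal_eq_bot_mk]⟩
  refine (Submodule.eq_bot_iff _).mpr fun x hx => hf.eq_zero fun i => ?_
  have hx' : ∀ l, ⟪v l, (⟨_, hf.star_apply_mem i x⟩ : V)⟫_ℝ = 0 := fun l => by
    rw [Submodule.coe_inner, inner_star_right]
    exact (Submodule.mem_orthogonal _ _).mp hx _ (Submodule.subset_span ⟨(i, l), rfl⟩)
  have : (⟨_, hf.star_apply_mem i x⟩ : V) = 0 := by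
    refine InnerProductSpace.ext_inner_left_basis v.toBasis fun l => ?_
    rw [OrthonormalBasis.coe_toBasis, hx', inner_zero_right]
  exact congrArg Subtype.val this

end IsFrame

open IsFrame (inner_mul_apply)

/-! ### Factors of real type. -/

theorem mul_of_kronecker_comm {m k : ℕ} (a : Matrix (Fin m) (Fin m) ℝ)
    (b : Matrix (Fin k) (Fin k) ℝ) :
    (a ⊗ₖ (1 : Matrix (Fin k) (Fin k) ℝ)) * ((1 : Matrix (Fin m) (Fin m) ℝ) ⊗ₖ b) =
      ((1 : Matrix (Fin m) (Fin m) ℝ) ⊗ₖ b) * (a ⊗ₖ (1 : Matrix (Fin k) (Fin k) ℝ)) := by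
  rw [← Matrix.mul_kronecker_mul, ← Matrix.mul_kronecker_mul]
  simp

/-- In a suitable orthonormal basis, `A` is the algebra of matrices `a ⊗ 1` and `B` is the algebra
of matrices `1 ⊗ b`. -/
def IsRealType (A B : Subalgebra ℝ (End ℝ E)) {m k : ℕ}
    (w : OrthonormalBasis (Fin m × Fin k) ℝ E) : Prop :=
  (∀ T, T ∈ A ↔ ∃ a : Matrix (Fin m) (Fin m) ℝ,
      LinearMap.toMatrixOrthonormal w T = a ⊗ₖ (1 : Matrix (Fin k) (Fin k) ℝ)) ∧
    ∀ T, T ∈ B ↔ ∃ b : Matrix (Fin k) (Fin k) ℝ,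
      LinearMap.toMatrixOrthonormal w T = (1 : Matrix (Fin m) (Fin m) ℝ) ⊗ₖ b

/-- Without skew elements the corner of `A` at `V` is reduced to scalars. A frame therefore gives `T
∈ A` a matrix of scalars `star (f i) * T * f j`, while `T ∈ B` commutes with the frame and acts
alike on all copies of `V`. Conversely, matrices `a ⊗ 1` and `1 ⊗ b` commute, and each algebra is
the full commutant of the other. -/
theorem IsDualPair.exists_isRealType {A B : Subalgebra ℝ (End ℝ E)} (h : IsDualPair A B)
    (hZ : IsFactor A B) {V : Submodule ℝ E} (hV : Irr (B : Set (End ℝ E)) V)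
    (hreal : ∀ K ∈ A, proj V * K = K → star K = -K → K = 0) :
    ∃ (m k : ℕ) (w : OrthonormalBasis (Fin m × Fin k) ℝ E), IsRealType A B w := by
  obtain ⟨m, f, hfA, hf⟩ := h.exists_frame hZ hV
  obtain ⟨k, v, w, hw⟩ := hf.exists_basis
  have hpA := h.proj_mem_left hV.1
  have hcorner : ∀ K ∈ A, proj V * K = K → K * proj V = K → ∃ μ : ℝ, K = μ • proj V := by
    intro K hK hpK hKp
    have hpsK : proj V * star K = star K := by
      have := congrArg star hKp
      rwa [star_mul, star_proj] at this
    have hsK := h.star_left K hK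
    obtain ⟨μ, hμ⟩ := h.exists_scalar hV (s := K + star K) (A.add_mem hK hsK)
      (by simp [add_comm]) (by rw [mul_add, hpK, hpsK])
    have h2 := hreal (K - star K) (A.sub_mem hK hsK) (by rw [mul_sub, hpK, hpsK]) (by simp)
    refine ⟨2⁻¹ * μ, ?_⟩
    rw [mul_smul, ← hμ, ← sub_eq_zero.mp h2]
    module
  have hvv : ∀ l l', ⟪(v l : E), (v l' : E)⟫_ℝ = if l = l' then 1 else 0 := fun l l' =>
    orthonormal_iff_ite.mp v.orthonormal l l'
  have hA : ∀ T ∈ A, ∃ a : Matrix (Fin m) (Fin m) ℝ,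
      LinearMap.toMatrixOrthonormal w T = a ⊗ₖ (1 : Matrix (Fin k) (Fin k) ℝ) := by
    intro T hT
    have hc : ∀ i j, ∃ μ : ℝ, star (f i) * T * f j = μ • proj V := fun i j =>
      hcorner _ (A.mul_mem (A.mul_mem (h.star_left _ (hfA i)) hT) (hfA j))
        (by rw [mul_assoc, ← mul_assoc (proj V), hf.proj_mul_star])
        (by rw [mul_assoc, hf.mul_proj])
    choose a ha using hc
    refine ⟨Matrix.of a, ?_⟩
    ext ⟨i, l⟩ ⟨j, l'⟩
    rw [LinearMap.toMatrixOrthonormal_apply_apply, hw, hw, inner_mul_apply f, ha,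
      LinearMap.smul_apply, proj_apply_of_mem (v l').2, real_inner_smul_right, hvv]
    simp [Matrix.kroneckerMap_apply, Matrix.one_apply]
  have hB : ∀ T ∈ B, ∃ b : Matrix (Fin k) (Fin k) ℝ,
      LinearMap.toMatrixOrthonormal w T = (1 : Matrix (Fin m) (Fin m) ℝ) ⊗ₖ b := by
    intro T hT
    refine ⟨Matrix.of fun l l' => ⟪(v l : E), T (v l')⟫_ℝ, ?_⟩
    ext ⟨i, l⟩ ⟨j, l'⟩
    rw [LinearMap.toMatrixOrthonormal_apply_apply, hw, hw, inner_mul_apply f, mul_assoc,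
      ← h.comm (hfA j) hT, ← mul_assoc, hf.star_mul]
    by_cases hij : i = j
    · subst hij
      have : proj V (T (v l')) = T (v l') := proj_apply_of_mem (hV.1 T hT _ (v l').2)
      simp [Matrix.kroneckerMap_apply, this]
    · simp [Matrix.kroneckerMap_apply, hij]
  refine ⟨m, k, w, fun T => ⟨hA T, ?_⟩, fun T => ⟨hB T, ?_⟩⟩
  · rintro ⟨a, ha⟩
    refine (h.mem_left T).mpr fun S hS => ?_
    obtain ⟨b, hb⟩ := hB S hS
    apply EquivLike.injective (LinearMap.toMatrixOrthonormal w)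
    rw [map_mul, map_mul, ha, hb, mul_of_kronecker_comm]
  · rintro ⟨b, hb⟩
    refine (h.mem_right T).mpr fun S hS => ?_
    obtain ⟨a, ha⟩ := hA S hS
    apply EquivLike.injective (LinearMap.toMatrixOrthonormal w)
    rw [map_mul, map_mul, ha, hb, mul_of_kronecker_comm]

theorem IsRealType.swap {A B : Subalgebra ℝ (End ℝ E)} {m k : ℕ}
    {w : OrthonormalBasis (Fin m × Fin k) ℝ E} (h : IsRealType A B w) :
    IsRealType B A (w.reindex (Equiv.prodComm _ _)) := by
  have key : ∀ (T : End ℝ E) (a : Matrix (Fin m) (Fin m) ℝ) (b : Matrix (Fin k) (Fin k) ℝ),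
      LinearMap.toMatrixOrthonormal (w.reindex (Equiv.prodComm _ _)) T = b ⊗ₖ a ↔
        LinearMap.toMatrixOrthonormal w T = a ⊗ₖ b := by
    intro T a b
    rw [← Matrix.ext_iff, ← Matrix.ext_iff]
    simp only [LinearMap.toMatrixOrthonormal_apply_apply, Prod.forall, Matrix.kroneckerMap_apply,
      OrthonormalBasis.reindex_apply, Equiv.prodComm_symm, Equiv.prodComm_apply, Prod.swap_prod_mk]
    constructor
    · intro H i l j l'
      rw [H, mul_comm]
    · intro H l i l' j
      rw [H, mul_comm]
  exact ⟨fun T => by simp only [key, h.2], fun T => by simp only [key, h.1]⟩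

theorem det_toMatrixOrthonormal {ι : Type*} [Fintype ι] [DecidableEq ι]
    (w : OrthonormalBasis ι ℝ E) (T : End ℝ E) :
    (LinearMap.toMatrixOrthonormal w T).det = LinearMap.det T :=
  LinearMap.det_toMatrix w.toBasis T

/-! ### Complex type -/

theorem inner_skew {J : End ℝ E} (hJs : star J = -J) (x y : E) : ⟪J x, y⟫_ℝ = -⟪x, J y⟫_ℝ := by
  rw [← inner_star_right, hJs, LinearMap.neg_apply, inner_neg_right]

theorem inner_skew_self {J : End ℝ E} (hJs : star J = -J) (x : E) : ⟪x, J x⟫_ℝ = 0 := by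
  have h := inner_skew hJs x x
  rw [real_inner_comm] at h
  linarith

theorem apply_apply_of_sq {J : End ℝ E} (hJ : J * J = -1) (x : E) : J (J x) = -x := by
  rw [← Module.End.mul_apply, hJ]; rfl

/-- A maximal family with this orthogonality serves. If `J` is a complex structure preserving `V`,
it is a unitary basis of `V`; the last clause then says that nothing in `V` is orthogonal to all `v
l` and `J (v l)`. -/
theorem exists_complex_basis {J : End ℝ E} (hJs : star J = -J) (V : Submodule ℝ E) :
    ∃ (k : ℕ) (v : Fin k → E), (∀ l, v l ∈ V) ∧
      (∀ l l', ⟪v l, v l'⟫_ℝ = if l = l' then 1 else 0) ∧ (∀ l l', ⟪v l, J (v l')⟫_ℝ = 0) ∧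
      ∀ x ∈ V, (∀ l, ⟪v l, x⟫_ℝ = 0) → (∀ l, ⟪v l, J x⟫_ℝ = 0) → x = 0 := by
  let P : ℕ → Prop := fun k => ∃ v : Fin k → E, (∀ l, v l ∈ V) ∧
      (∀ l l', ⟪v l, v l'⟫_ℝ = if l = l' then 1 else 0) ∧ (∀ l l', ⟪v l, J (v l')⟫_ℝ = 0)
  have h0 : P 0 := ⟨Fin.elim0, fun i => i.elim0, fun i => i.elim0, fun i => i.elim0⟩
  have hN : ¬ P (finrank ℝ E + 1) := by
    rintro ⟨v, -, hv, -⟩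
    have := (orthonormal_iff_ite.mpr hv).linearIndependent.fintype_card_le_finrank
    simp at this
  obtain ⟨k, ⟨v, hvV, hv, hvJ⟩, hk⟩ := exists_last h0 hN
  refine ⟨k, v, hvV, hv, hvJ, fun x hx hx1 hx2 => ?_⟩
  by_contra hx0
  have hn : ‖x‖ ≠ 0 := norm_ne_zero_iff.mpr hx0
  have hxv : ∀ l, ⟪x, v l⟫_ℝ = 0 := fun l => by rw [real_inner_comm, hx1]
  have hxJv : ∀ l, ⟪x, J (v l)⟫_ℝ = 0 := fun l => by
    rw [real_inner_comm, inner_skew hJs, hx2, neg_zero]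
  refine hk ⟨Fin.snoc v (‖x‖⁻¹ • x), fun l => ?_, fun l l' => ?_, fun l l' => ?_⟩
  · induction l using Fin.lastCases with
    | last => simpa using V.smul_mem _ hx
    | cast i => simpa using hvV i
  · induction l using Fin.lastCases with
    | last =>
      induction l' using Fin.lastCases with
      | last =>
        simp only [Fin.snoc_last, if_true]
        rw [real_inner_smul_left, real_inner_smul_right, real_inner_self_eq_norm_sq]
        field_simp
      | cast j => simp [real_inner_smul_left, hxv, (Fin.castSucc_lt_last j).ne']
    | cast i =>
      induction l' using Fin.lastCases with
      | last => simp [real_inner_smul_right, hx1, (Fin.castSucc_lt_last i).ne]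
      | cast j => simpa using hv i j
  · induction l using Fin.lastCases with
    | last =>
      induction l' using Fin.lastCases with
      | last => simp [real_inner_smul_left, real_inner_smul_right, inner_skew_self hJs]
      | cast j => simp [real_inner_smul_left, hxJv]
    | cast i =>
      induction l' using Fin.lastCases with
      | last => simp [real_inner_smul_right, hx2]
      | cast j => simpa using hvJ i j

theorem fieldRestriction_one {m : ℕ} :
    Howe.fieldRestriction (1 : Matrix (Fin m) (Fin m) ℂ) = 1 := by
  ext (i | i) (j | j) <;> simp [Howe.fieldRestriction, Matrix.one_apply] <;> split_ifs <;> simp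

/-- In a suitable orthonormal basis, `A` is the algebra of matrices `φ(a) ⊗ 1`, where `φ` is the
field restriction from complex to real matrices. -/
def IsComplexType (A : Subalgebra ℝ (End ℝ E)) {m k : ℕ}
    (w : OrthonormalBasis ((Fin m ⊕ Fin m) × Fin k) ℝ E) : Prop :=
  ∀ T, T ∈ A ↔ ∃ a : Matrix (Fin m) (Fin m) ℂ, LinearMap.toMatrixOrthonormal w T =
    Howe.fieldRestriction a ⊗ₖ (1 : Matrix (Fin k) (Fin k) ℝ)

/-- The corner of `A` at `V` is spanned by `proj V` and `J * proj V`: for `K` in it, `K + star K`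
and `(K - star K) * J` are both symmetric, as `J` is skew and central, hence scalar on `V`. So a
frame gives `T ∈ A` a complex matrix. -/
theorem IsDualPair.exists_isComplexType {A B : Subalgebra ℝ (End ℝ E)} (h : IsDualPair A B)
    (hZ : IsFactor A B) {V : Submodule ℝ E} (hV : Irr (B : Set (End ℝ E)) V)
    {J : End ℝ E} (hJA : J ∈ A) (hJB : J ∈ B) (hJ : J * J = -1) (hJs : star J = -J) :
    ∃ (m k : ℕ) (w : OrthonormalBasis ((Fin m ⊕ Fin m) × Fin k) ℝ E), IsComplexType A w ∧
      LinearMap.toMatrixOrthonormal w J =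
        Howe.fieldRestriction (Complex.I • 1) ⊗ₖ (1 : Matrix (Fin k) (Fin k) ℝ) := by
  obtain ⟨m, f, hfA, hf⟩ := h.exists_frame hZ hV
  have hJV : ∀ x ∈ V, J x ∈ V := hV.1 J hJB
  obtain ⟨k, v, hvV, hv, hvJ, hvmax⟩ := exists_complex_basis hJs V
  have hpA := h.proj_mem_left hV.1
  have hpJ : proj V * J = J * proj V := h.comm hpA hJB
  have hcorner : ∀ K ∈ A, proj V * K = K → K * proj V = K →
      ∃ z : ℂ, K = z.re • proj V + z.im • (J * proj V) := by
    intro K hK hpK hKp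
    have hpsK : proj V * star K = star K := by
      have := congrArg star hKp
      rwa [star_mul, star_proj] at this
    have hsK := h.star_left K hK
    obtain ⟨μ, hμ⟩ := h.exists_scalar hV (s := K + star K) (A.add_mem hK hsK)
      (by simp [add_comm]) (by rw [mul_add, hpK, hpsK])
    have hD := A.sub_mem hK hsK
    obtain ⟨ν, hν⟩ := h.exists_scalar hV (s := (K - star K) * J) (A.mul_mem hD hJA)
      (by rw [star_mul, star_sub, star_star, hJs, h.comm hD hJB]; noncomm_ring)
      (by rw [← mul_assoc, mul_sub, hpK, hpsK])
    have hν' : K - star K = -ν • (J * proj V) := by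
      have h1 := congrArg (fun T => T * J) hν
      simp only [mul_assoc, hJ, smul_mul_assoc, hpJ, mul_neg, mul_one] at h1
      rw [neg_smul, ← h1, neg_neg]
    refine ⟨⟨2⁻¹ * μ, -(2⁻¹ * ν)⟩, ?_⟩
    have h3 : (2 : ℝ) • K = (K + star K) + (K - star K) := by module
    rw [hμ, hν'] at h3
    have h4 : K = (2⁻¹ : ℝ) • ((2 : ℝ) • K) := by module
    rw [h4, h3]
    module
  -- The sign in `-J` is the one for which `J` itself becomes the field restriction of `i`, whose
  -- upper right block is `+1`.
  let w₀ : (Fin m ⊕ Fin m) × Fin k → E := fun a =>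
    Sum.elim (fun i => f i (v a.2)) (fun i => f i (-J (v a.2))) a.1
  have hentry : ∀ (T : End ℝ E) (a : Matrix (Fin m) (Fin m) ℂ),
      (∀ i j, star (f i) * T * f j = (a i j).re • proj V + (a i j).im • (J * proj V)) →
      ∀ r s, ⟪w₀ r, T (w₀ s)⟫_ℝ =
        (Howe.fieldRestriction a ⊗ₖ (1 : Matrix (Fin k) (Fin k) ℝ)) r s := by
    rintro T a hT ⟨i | i, l⟩ ⟨j | j, l'⟩ <;>
    simp only [w₀, Sum.elim_inl, Sum.elim_inr, IsFrame.inner_mul_apply, hT, Matrix.kroneckerMap_apply,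
      Howe.fieldRestriction, Matrix.fromBlocks_apply₁₁, Matrix.fromBlocks_apply₁₂,
      Matrix.fromBlocks_apply₂₁, Matrix.fromBlocks_apply₂₂, Matrix.map_apply, Matrix.neg_apply,
      LinearMap.add_apply, LinearMap.smul_apply, Module.End.mul_apply,
      proj_apply_of_mem (hvV _), map_neg, map_add, map_smul, proj_apply_of_mem (hJV _ (hvV _)),
      inner_add_right, inner_smul_right, inner_neg_left, inner_neg_right,
      apply_apply_of_sq hJ, hv, hvJ, inner_skew hJs, Matrix.one_apply, neg_neg] <;>
    split_ifs <;> simp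
  have hw : Orthonormal ℝ w₀ := by
    rw [orthonormal_iff_ite]
    intro r s
    have := hentry 1 1 (fun i j => by
      rw [mul_one, hf.star_mul, Matrix.one_apply]; split_ifs <;> simp) r s
    rw [Module.End.one_apply] at this
    rw [this]
    rw [fieldRestriction_one, Matrix.one_kronecker_one, Matrix.one_apply]
  have hcomp : (Submodule.span ℝ (Set.range w₀))ᗮ = ⊥ := by
    refine (Submodule.eq_bot_iff _).mpr fun x hx => hf.eq_zero fun i => ?_
    have hx := fun a => (Submodule.mem_orthogonal _ _).mp hx _ (Submodule.subset_span ⟨a, rfl⟩)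
    refine hvmax _ (hf.star_apply_mem i x) (fun l => ?_) (fun l => ?_)
    · rw [inner_star_right]; exact hx (Sum.inl i, l)
    · have := hx (Sum.inr i, l)
      simp only [w₀, Sum.elim_inr] at this
      rw [← inner_star_right, inner_neg_left, inner_skew hJs] at this
      simpa using this
  let w := OrthonormalBasis.mkOfOrthogonalEqBot hw hcomp
  have hw' : ∀ a, w a = w₀ a := fun a => by
    rw [OrthonormalBasis.coe_of_orthogonal_eq_bot_mk]
  have hmat : ∀ (T : End ℝ E) (a : Matrix (Fin m) (Fin m) ℂ),
      (∀ i j, star (f i) * T * f j = (a i j).re • proj V + (a i j).im • (J * proj V)) →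
      LinearMap.toMatrixOrthonormal w T =
        Howe.fieldRestriction a ⊗ₖ (1 : Matrix (Fin k) (Fin k) ℝ) := by
    intro T a hT
    ext r s
    rw [LinearMap.toMatrixOrthonormal_apply_apply, hw', hw', hentry T a hT]
  refine ⟨m, k, w, fun T => ⟨fun hT => ?_, ?_⟩, hmat J _ fun i j => ?_⟩
  · have hc : ∀ i j, ∃ z : ℂ, star (f i) * T * f j = z.re • proj V + z.im • (J * proj V) :=
      fun i j => hcorner _ (A.mul_mem (A.mul_mem (h.star_left _ (hfA i)) hT) (hfA j))
        (by rw [mul_assoc, ← mul_assoc (proj V), hf.proj_mul_star])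
        (by rw [mul_assoc, hf.mul_proj])
    choose a ha using hc
    exact ⟨Matrix.of a, hmat T _ ha⟩
  · rintro ⟨a, ha⟩
    -- An element of `A` with the prescribed matrix: the frame supplies matrix units and `J` the
    -- imaginary unit.
    let T' : End ℝ E := ∑ i, ∑ j, f i * ((a i j).re • 1 + (a i j).im • J) * star (f j)
    have hT'A : T' ∈ A := A.sum_mem fun i _ => A.sum_mem fun j _ =>
      A.mul_mem (A.mul_mem (hfA i) (A.add_mem (A.smul_mem A.one_mem _) (A.smul_mem hJA _)))
        (h.star_left _ (hfA j))
    have hT' := hmat T' a fun i j => by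
      have hterm : ∀ i' j', star (f i) * (f i' * ((a i' j').re • 1 + (a i' j').im • J) *
          star (f j')) * f j = if i = i' then (if j' = j then
            ((a i' j').re • proj V + (a i' j').im • (J * proj V)) else 0) else 0 := by
        intro i' j'
        have e : star (f i) * (f i' * ((a i' j').re • 1 + (a i' j').im • J) * star (f j')) * f j =
          (star (f i) * f i') * ((a i' j').re • 1 + (a i' j').im • J) * (star (f j') * f j) := by
          simp only [mul_assoc]
        rw [e, hf.star_mul, hf.star_mul]
        split_ifs
        · rw [mul_add, add_mul]
          simp [hpJ, proj_mul_proj, mul_assoc]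
        all_goals simp
      simp only [T', Finset.mul_sum, Finset.sum_mul, hterm]
      simp
    have : T = T' := EquivLike.injective (LinearMap.toMatrixOrthonormal w) (ha.trans hT'.symm)
    exact this ▸ hT'A
  · rw [mul_assoc, ← h.comm (hfA j) hJB, ← mul_assoc, hf.star_mul]
    by_cases hij : i = j
    · subst hij; simp [hpJ]
    · simp [hij]

/-! ### Complex structures from skew elements -/

/-- `K * K = -(star K * K)` is negative semidefinite and nonzero, so `μ < 0` and the scale is `1 /
√(-μ)`. It is applied with `Q` the identity or the projection onto an irreducible subspace. -/
theorem exists_smul_sq_eq_neg {K Q : End ℝ E} (hK : star K = -K) (hK0 : K ≠ 0) {μ : ℝ}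
    (hμ : K * K = μ • Q) (hQs : star Q = Q) (hQ : Q * Q = Q) :
    ∃ r : ℝ, (r • K) * (r • K) = -Q := by
  obtain ⟨x, hx⟩ : ∃ x, K x ≠ 0 := by
    by_contra! h
    exact hK0 (LinearMap.ext h)
  have h1 : ⟪x, (K * K) x⟫_ℝ = -⟪K x, K x⟫_ℝ := by
    rw [Module.End.mul_apply, inner_skew hK, neg_neg]
  have h2 : ⟪x, Q x⟫_ℝ = ⟪Q x, Q x⟫_ℝ := by
    conv_lhs => rw [← hQ, Module.End.mul_apply, ← inner_star_left, hQs]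
  rw [hμ, LinearMap.smul_apply, real_inner_smul_right, h2] at h1
  have h3 : 0 < ⟪K x, K x⟫_ℝ := real_inner_self_pos.mpr hx
  have h4 : 0 ≤ ⟪Q x, Q x⟫_ℝ := real_inner_self_nonneg
  have hneg : μ < 0 := by
    by_contra! h
    have := mul_nonneg h h4
    linarith
  refine ⟨(√(-μ))⁻¹, ?_⟩
  have h5 : √(-μ) ≠ 0 := (Real.sqrt_pos.mpr (neg_pos.mpr hneg)).ne'
  have h6 : √(-μ) ^ 2 = -μ := Real.sq_sqrt (neg_pos.mpr hneg).le
  rw [smul_mul_smul_comm, hμ, smul_smul]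
  have : (√(-μ))⁻¹ * (√(-μ))⁻¹ * μ = -1 := by
    field_simp
    linarith
  rw [this, neg_one_smul]

namespace IsDualPair

variable {A B : Subalgebra ℝ (End ℝ E)}

/-- A factor is of real type or contains a complex structure. -/
theorem isRealType_or_exists_sq_eq_neg_one [Nontrivial E] (h : IsDualPair A B)
    (hZ : IsFactor A B) :
    (∃ (m k : ℕ) (w : OrthonormalBasis (Fin m × Fin k) ℝ E), IsRealType A B w) ∨
      ∃ L ∈ A, L * L = -1 := by
  obtain ⟨V, -, hV⟩ := exists_irr_le (S := (B : Set (End ℝ E))) (V := ⊤)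
    (fun _ _ _ _ => Submodule.mem_top) top_ne_bot
  by_cases hreal : ∀ K ∈ A, proj V * K = K → star K = -K → K = 0
  · exact Or.inl (h.exists_isRealType hZ hV hreal)
  · right
    push Not at hreal
    obtain ⟨K, hK, hpK, hKs, hK0⟩ := hreal
    obtain ⟨μ, hμ⟩ := h.exists_scalar hV (s := K * K) (A.mul_mem hK hK)
      (by rw [star_mul, hKs, neg_mul_neg]) (by rw [← mul_assoc, hpK])
    obtain ⟨r, hr⟩ := exists_smul_sq_eq_neg hKs hK0 hμ (star_proj V) (proj_mul_proj V)
    obtain ⟨m, f, hfA, hf⟩ := h.exists_frame hZ hV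
    -- The rescaled `K` is a complex structure on `V`; the frame copies it to all of `E`.
    refine ⟨∑ i, f i * (r • K) * star (f i), A.sum_mem fun i _ =>
      A.mul_mem (A.mul_mem (hfA i) (A.smul_mem hK r)) (h.star_left _ (hfA i)), ?_⟩
    have hKp : K * proj V = K := by
      have := congrArg star hpK
      simpa [hKs, star_proj] using this
    have hterm : ∀ i j, (f i * (r • K) * star (f i)) * (f j * (r • K) * star (f j)) =
        if i = j then -(f i * star (f i)) else 0 := by
      intro i j
      have e : (f i * (r • K) * star (f i)) * (f j * (r • K) * star (f j)) =
        f i * ((r • K) * (star (f i) * f j) * (r • K)) * star (f j) := by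
        simp only [mul_assoc]
      rw [e, hf.star_mul]
      split_ifs with hij
      · subst hij
        rw [smul_mul_assoc, hKp, hr]
        simp [hf.mul_proj]
      · simp
    simp only [Finset.sum_mul, Finset.mul_sum, hterm]
    simp [hf.sum]

/-! ### The center is trivial: all automorphisms are inner -/

/-- The projection onto a subspace stable under `A` and `B` is central, hence scalar, so the
generated algebra acts irreducibly. Its commutant is the center, thus `ℝ`, and Jacobson density
gives every endomorphism. -/
theorem adjoin_eq_top (h : IsDualPair A B) (hZ : ∀ z ∈ A, z ∈ B → ∃ μ : ℝ, z = μ • 1) :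
    Algebra.adjoin ℝ ((A : Set (End ℝ E)) ∪ B) = ⊤ := by
  rcases subsingleton_or_nontrivial E with hE | hE
  · refine eq_top_iff.mpr fun T _ => ?_
    have : T = 0 := LinearMap.ext fun x => Subsingleton.elim _ _
    exact this ▸ Subalgebra.zero_mem _
  set R := Algebra.adjoin ℝ ((A : Set (End ℝ E)) ∪ B)
  have hA : ∀ a ∈ A, a ∈ R := fun a ha => Algebra.subset_adjoin (Or.inl ha)
  have hB : ∀ b ∈ B, b ∈ R := fun b hb => Algebra.subset_adjoin (Or.inr hb)
  have hscal : ∀ z : End ℝ E, (∀ a ∈ A, a * z = z * a) → (∀ b ∈ B, z * b = b * z) →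
      ∃ μ : ℝ, z = μ • 1 := fun z h1 h2 => hZ z ((h.mem_left z).mpr h2) ((h.mem_right z).mpr h1)
  have hsimple : IsSimpleModule R E := by
    refine { exists_pair_ne := ⟨⊥, ⊤, bot_ne_top⟩, eq_bot_or_eq_top := fun U => ?_ }
    let V : Submodule ℝ E := U.restrictScalars ℝ
    have hVmem : ∀ T ∈ R, ∀ x ∈ V, T x ∈ V := fun T hT x hx => U.smul_mem ⟨T, hT⟩ hx
    have hVR : ∀ T ∈ R, star T ∈ R → T * proj V = proj V * T := fun T hT hT' =>
      mul_proj_eq_proj_mul (hVmem T hT) (hVmem _ hT')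
    obtain ⟨μ, hμ⟩ := hscal (proj V)
      (fun a ha => hVR a (hA a ha) (hA _ (h.star_left a ha)))
      (fun b hb => (hVR b (hB b hb) (hB _ (h.star_right b hb))).symm)
    by_cases h0 : μ = 0
    · left
      rw [Submodule.eq_bot_iff]
      intro x hx
      have : proj V x = x := proj_apply_of_mem hx
      rw [← this, hμ, h0]
      simp
    · right
      rw [Submodule.eq_top_iff']
      intro x
      have : μ • x ∈ V := by
        have := proj_mem V x
        rwa [hμ] at this
      have h2 := V.smul_mem μ⁻¹ this
      rw [smul_smul, inv_mul_cancel₀ h0, one_smul] at h2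
      exact h2
  refine eq_top_iff.mpr fun T _ => ?_
  have hEnd : ∀ g : Module.End R E, ∃ μ : ℝ, ∀ x, g x = μ • x := by
    intro g
    obtain ⟨μ, hμ⟩ := hscal (g.restrictScalars ℝ)
      (fun a ha => LinearMap.ext fun x => (map_smul g (⟨a, hA a ha⟩ : R) x).symm)
      (fun b hb => LinearMap.ext fun x => map_smul g (⟨b, hB b hb⟩ : R) x)
    exact ⟨μ, fun x => congrArg (fun S : End ℝ E => S x) hμ⟩
  let T' : Module.End (Module.End R E) E :=
    { toFun := T
      map_add' := map_add T
      map_smul' := fun g x => by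
        obtain ⟨μ, hμ⟩ := hEnd g
        simp [hμ] }
  classical
  let b := Module.finBasis ℝ E
  obtain ⟨r, hr⟩ := jacobson_density (R := R) T' (Finset.univ.image b)
  have : T = (r : End ℝ E) := b.ext fun i => hr (b i) (by simp)
  exact this ▸ r.2

theorem trace_star_mul_self_eq_zero {T : End ℝ E} (hT : LinearMap.trace ℝ E (star T * T) = 0) :
    T = 0 := by
  let b := stdOrthonormalBasis ℝ E
  rw [LinearMap.trace_eq_sum_inner _ b] at hT
  have h1 : ∀ i, ⟪b i, (star T * T) (b i)⟫_ℝ = ⟪T (b i), T (b i)⟫_ℝ := fun i => by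
    rw [Module.End.mul_apply, inner_star_right]
  simp only [h1] at hT
  rw [Finset.sum_eq_zero_iff_of_nonneg fun i _ => real_inner_self_nonneg] at hT
  exact b.toBasis.ext fun i => by simpa using hT i (Finset.mem_univ i)

/-- The form `trace (x * z)` is nondegenerate on the star-closed algebra `A`, because `trace (star x
* x)` vanishes only for `x = 0`. So it represents every functional on `A`. -/
theorem exists_trace_proj (hA : ∀ a ∈ A, star a ∈ A) (y : End ℝ E) :
    ∃ x ∈ A, ∀ z ∈ A, LinearMap.trace ℝ E (x * z) = LinearMap.trace ℝ E (y * z) := by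
  let β : End ℝ E →ₗ[ℝ] A →ₗ[ℝ] ℝ := LinearMap.mk₂ ℝ (fun x z => LinearMap.trace ℝ E (x * z))
    (fun x y z => by simp [add_mul]) (fun r x z => by simp)
    (fun x z z' => by simp [mul_add]) (fun r x z => by simp)
  let β' : A →ₗ[ℝ] Module.Dual ℝ A := β ∘ₗ A.val.toLinearMap
  have hinj : Function.Injective β' := by
    rw [← LinearMap.ker_eq_bot, LinearMap.ker_eq_bot']
    intro x hx
    have : LinearMap.trace ℝ E (x * star (x : End ℝ E)) = 0 :=
      congrArg (fun f : Module.Dual ℝ A => f ⟨star x, hA x x.2⟩) hx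
    rw [LinearMap.trace_mul_comm] at this
    exact Subtype.ext (trace_star_mul_self_eq_zero this)
  have hsurj : Function.Surjective β' :=
    (LinearMap.injective_iff_surjective_of_finrank_eq_finrank
      Subspace.dual_finrank_eq.symm).mp hinj
  obtain ⟨x, hx⟩ := hsurj (β y)
  exact ⟨x, x.2, fun z hz => congrArg (fun f : Module.Dual ℝ A => f ⟨z, hz⟩) hx⟩

/-- If the center is trivial, the normalizer of `A` in the orthogonal group is the product of the
orthogonal elements of `A` and of `B`. -/
theorem exists_mul_eq_of_normalizes (h : IsDualPair A B)
    (hZ : ∀ z ∈ A, z ∈ B → ∃ μ : ℝ, z = μ • 1) {c : End ℝ E} (hc : star c * c = 1)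
    (hcA : ∀ a ∈ A, c * a * star c ∈ A) :
    ∃ x ∈ A, ∃ y ∈ B, star x * x = 1 ∧ star y * y = 1 ∧ c = x * y := by
  rcases subsingleton_or_nontrivial E with hE | hE
  · have hsub : ∀ S T : End ℝ E, S = T := fun S T => LinearMap.ext fun x => Subsingleton.elim _ _
    exact ⟨1, A.one_mem, 1, B.one_mem, hsub _ _, hsub _ _, hsub _ _⟩
  have hc' := mul_star_eq_one hc
  -- A nonzero intertwiner between `a` and `c * a * star c` inside `A`. Each `c * b` with `b ∈ B`
  -- intertwines, and so does its trace projection to `A`. If all these projections vanished, `trace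
  -- (c * d)` would be zero for every `d` in the algebra generated by `A` and `B`, in particular for
  -- `d = star c`.
  obtain ⟨x, hx, hx0, hxc⟩ : ∃ x ∈ A, x ≠ 0 ∧ ∀ a ∈ A, x * a = c * a * star c * x := by
    by_contra! H
    have hzero : ∀ b ∈ B, ∀ a ∈ A, LinearMap.trace ℝ E (c * b * a) = 0 := by
      intro b hb a ha
      obtain ⟨x, hx, hxt⟩ := exists_trace_proj h.star_left (c * b)
      have hxc : ∀ a ∈ A, x * a = c * a * star c * x := by
        intro a ha
        have hσ := hcA a ha
        rw [← sub_eq_zero]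
        set D := x * a - c * a * star c * x with hD
        have hDA : D ∈ A := A.sub_mem (A.mul_mem hx ha) (A.mul_mem hσ hx)
        apply trace_star_mul_self_eq_zero
        rw [LinearMap.trace_mul_comm]
        have hs := h.star_left D hDA
        set z := star D
        have e1 : LinearMap.trace ℝ E (x * a * z) = LinearMap.trace ℝ E (c * b * (a * z)) := by
          rw [mul_assoc, hxt _ (A.mul_mem ha hs)]
        have e2 : LinearMap.trace ℝ E (c * a * star c * x * z) =
            LinearMap.trace ℝ E (c * b * (a * z)) := by
          rw [mul_assoc, LinearMap.trace_mul_comm, mul_assoc, hxt _ (A.mul_mem hs hσ),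
            ← mul_assoc, LinearMap.trace_mul_comm]
          congr 1
          calc c * a * star c * (c * b * z) = c * a * (star c * c) * b * z := by
                simp only [mul_assoc]
            _ = c * (a * b) * z := by rw [hc]; simp only [mul_assoc, one_mul]
            _ = c * b * (a * z) := by rw [h.comm ha hb]; simp only [mul_assoc]
        rw [hD, sub_mul, map_sub, e1, e2, sub_self]
      have hx0 : x = 0 := by
        by_contra hx0
        obtain ⟨a, ha, hne⟩ := H x hx hx0
        exact hne (hxc a ha)
      rw [← hxt a ha, hx0, zero_mul, map_zero]
    have hind : ∀ d ∈ Algebra.adjoin ℝ ((A : Set (End ℝ E)) ∪ B), ∀ e : End ℝ E,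
        (∀ b ∈ B, ∀ a ∈ A, LinearMap.trace ℝ E (c * b * a * e) = 0) →
        ∀ b ∈ B, ∀ a ∈ A, LinearMap.trace ℝ E (c * b * a * (d * e)) = 0 := by
      intro d hd
      induction hd using Algebra.adjoin_induction with
      | mem d hd =>
        intro e he b hb a ha
        rcases hd with hd | hd
        · have := he b hb _ (A.mul_mem ha hd)
          simpa only [mul_assoc] using this
        · have := he _ (B.mul_mem hb hd) a ha
          rw [mul_assoc (c * b), ← mul_assoc a, h.comm ha hd]
          simpa only [mul_assoc] using this
      | algebraMap r =>
        intro e he b hb a ha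
        simp [Algebra.algebraMap_eq_smul_one, he b hb a ha]
      | add d d' _ _ hd hd' =>
        intro e he b hb a ha
        rw [add_mul, mul_add, map_add, hd e he b hb a ha, hd' e he b hb a ha, add_zero]
      | mul d d' _ _ hd hd' =>
        intro e he b hb a ha
        rw [mul_assoc d]
        exact hd _ (hd' e he) b hb a ha
    have h1 := hind (star c) (h.adjoin_eq_top hZ ▸ Algebra.mem_top) 1
      (fun b hb a ha => by rw [mul_one]; exact hzero b hb a ha) 1 B.one_mem 1 A.one_mem
    simp only [mul_one, hc', LinearMap.trace_one] at h1
    have := Module.finrank_pos (R := ℝ) (M := E)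
    exact this.ne' (by exact_mod_cast h1)
  have hxs : ∀ a ∈ A, a * star x = star x * (c * a * star c) := fun a ha => by
    have := congrArg star (hxc _ (h.star_left a ha))
    simpa [mul_assoc] using this
  have hxx : star x * x ∈ A := A.mul_mem (h.star_left x hx) hx
  -- The intertwining relation and its adjoint make `star x * x` central. It is then a positive
  -- scalar, so `x` can be rescaled to an orthogonal `x'`, and `star x' * c` commutes with `A`.
  obtain ⟨μ, hμ⟩ := hZ (star x * x) hxx ((h.mem_right _).mpr fun a ha => by
    rw [← mul_assoc, hxs a ha, mul_assoc, ← hxc a ha, mul_assoc])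
  obtain ⟨v, hv⟩ : ∃ v, x v ≠ 0 := by
    by_contra! H
    exact hx0 (LinearMap.ext H)
  have hμpos : 0 < μ := by
    have h1 : ⟪v, (star x * x) v⟫_ℝ = μ * ⟪v, v⟫_ℝ := by
      rw [hμ, LinearMap.smul_apply, Module.End.one_apply, real_inner_smul_right]
    rw [Module.End.mul_apply, inner_star_right] at h1
    have h2 : 0 < ⟪x v, x v⟫_ℝ := real_inner_self_pos.mpr hv
    rw [h1] at h2
    exact pos_of_mul_pos_left h2 real_inner_self_nonneg
  have hs : (√μ)⁻¹ * (√μ)⁻¹ * μ = 1 := by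
    have h5 : √μ ≠ 0 := (Real.sqrt_pos.mpr hμpos).ne'
    field_simp
    exact (Real.sq_sqrt hμpos.le).symm
  set x' := (√μ)⁻¹ • x with hx'
  have hx'A : x' ∈ A := A.smul_mem hx _
  have hx'1 : star x' * x' = 1 := by
    rw [hx', star_smul, star_trivial, smul_mul_smul_comm, hμ, smul_smul, hs, one_smul]
  have hx's : ∀ a ∈ A, a * star x' = star x' * (c * a * star c) := fun a ha => by
    rw [hx', star_smul, star_trivial, mul_smul_comm, hxs a ha, smul_mul_assoc]
  refine ⟨x', hx'A, star x' * c, (h.mem_right _).mpr fun a ha => ?_, hx'1, ?_, ?_⟩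
  · rw [← mul_assoc, hx's a ha]
    calc star x' * (c * a * star c) * c = star x' * (c * a) * (star c * c) := by
          simp only [mul_assoc]
      _ = _ := by rw [hc]; simp only [mul_assoc, mul_one]
  · have : x' * star x' = 1 := mul_star_eq_one hx'1
    calc star (star x' * c) * (star x' * c) = star c * (x' * star x') * c := by
          simp only [star_mul, star_star, mul_assoc]
      _ = 1 := by rw [this, mul_one, hc]
  · rw [← mul_assoc, mul_star_eq_one hx'1, one_mul]

end IsDualPair

/-! ### Factors with an orientation reversing normalizer -/

/-- `A` is an `O`-type algebra of odd rank or multiplicity, or a `U`-type algebra of odd rank and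
multiplicity. -/
def HasOddType (A : Subalgebra ℝ (End ℝ E)) : Prop :=
  (∃ m k : ℕ, (Odd m ∨ Odd k) ∧ ∃ w : OrthonormalBasis (Fin m × Fin k) ℝ E, ∀ T, T ∈ A ↔
    ∃ a : Matrix (Fin m) (Fin m) ℝ,
      LinearMap.toMatrixOrthonormal w T = a ⊗ₖ (1 : Matrix (Fin k) (Fin k) ℝ)) ∨
  (∃ m k : ℕ, Odd m ∧ Odd k ∧ ∃ w : OrthonormalBasis ((Fin m ⊕ Fin m) × Fin k) ℝ E,
    IsComplexType A w)

/-- Here `det x = (det a)^k` and `det y = (det b)^m`, and an even power of a real number is never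
-1. -/
theorem IsRealType.odd {A B : Subalgebra ℝ (End ℝ E)} {m k : ℕ}
    {w : OrthonormalBasis (Fin m × Fin k) ℝ E} (hw : IsRealType A B w) {x y : End ℝ E} (hx : x ∈ A)
    (hy : y ∈ B) (hdet : LinearMap.det x = -1 ∨ LinearMap.det y = -1) : Odd m ∨ Odd k := by
  have key : ∀ (d : ℝ) (j : ℕ), d ^ j = -1 → Odd j := fun d j hd => by
    by_contra hj
    have := (Nat.not_odd_iff_even.mp hj).pow_nonneg d
    linarith
  rcases hdet with hd | hd
  · right
    obtain ⟨a, ha⟩ := (hw.1 x).mp hx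
    rw [← det_toMatrixOrthonormal w, ha, Matrix.det_kronecker] at hd
    exact key a.det k (by simpa using hd)
  · left
    obtain ⟨b, hb⟩ := (hw.2 y).mp hy
    rw [← det_toMatrixOrthonormal w, hb, Matrix.det_kronecker] at hd
    exact key b.det m (by simpa using hd)

theorem IsDualPair.hasOddType_of_skew [Nontrivial E] {A B : Subalgebra ℝ (End ℝ E)}
    (h : IsDualPair A B) (hZ : IsFactor A B) {c : End ℝ E} (hc : star c * c = 1)
    (hcA : ∀ T, T ∈ A ↔ c * T * star c ∈ A) (hdet : LinearMap.det c = -1)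
    {J : End ℝ E} (hJA : J ∈ A) (hJB : J ∈ B) (hJ : J * J = -1) (hJs : star J = -J) :
    HasOddType A := by
  have hJ' : c * J * star c ∈ A := (hcA J).mp hJA
  have hJ'B : c * J * star c ∈ B := (h.conj_mem_right hc hcA J).mp hJB
  -- `c * J * star c` is again a central complex structure. Its product with `J` is symmetric and
  -- central, hence a scalar `μ`, and `c` commutes with `J` up to the factor `-μ`.
  obtain ⟨μ, hμ⟩ := hZ (c * J * star c * J) (A.mul_mem hJ' hJA) (B.mul_mem hJ'B hJB) (by
    have hJ's : star (c * J * star c) = -(c * J * star c) := by simp [hJs, mul_assoc]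
    rw [star_mul, hJ's, hJs, neg_mul_neg, h.comm hJA hJ'B])
  have hcJ : c * J = (-μ) • (J * c) := by
    have h1 : c * J * star c * J * (J * c) = c * J * star c * (J * J) * c := by
      simp only [mul_assoc]
    have h2 : c * J * star c * (J * J) * c = -(c * J * (star c * c)) := by
      rw [hJ]; simp [mul_assoc]
    rw [h2, hc, mul_one, hμ, smul_mul_assoc, one_mul] at h1
    rw [neg_smul, h1, neg_neg]
  have hμ2 : μ * μ = 1 := by
    have h1 : c * (J * J) = (μ * μ) • (J * J * c) := by
      rw [← mul_assoc, hcJ, smul_mul_assoc, mul_assoc, hcJ, mul_smul_comm, smul_smul, neg_mul_neg,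
        mul_assoc]
    rw [hJ, mul_neg, neg_mul, mul_one, one_mul, smul_neg, neg_inj] at h1
    have h2 := congrArg (fun T => T * star c) h1
    simp only [smul_mul_assoc, mul_star_eq_one hc] at h2
    obtain ⟨x, hx⟩ := exists_ne (0 : E)
    have h3 := congrArg (fun T : End ℝ E => T x) h2
    simp only [Module.End.one_apply, LinearMap.smul_apply] at h3
    have h4 : (μ * μ - 1) • x = 0 := by rw [sub_smul, ← h3, one_smul, sub_self]
    exact sub_eq_zero.mp ((smul_eq_zero.mp h4).resolve_right hx)
  rcases mul_self_eq_one_iff.mp hμ2 with rfl | rfl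
  swap
  -- For `μ = -1` the map `c` is complex linear, contradicting its negative determinant.
  · have := det_nonneg_of_commute hJ (by simpa using hcJ)
    rw [hdet] at this
    norm_num at this
  obtain ⟨V, -, hV⟩ := exists_irr_le (S := (B : Set (End ℝ E))) (V := ⊤)
    (fun _ _ _ _ => Submodule.mem_top) top_ne_bot
  obtain ⟨m, k, w, hw, hwJ⟩ := h.exists_isComplexType hZ hV hJA hJB hJ hJs
  -- `Q ⊗ 1` is complex conjugation `κ`. Both `c` and `κ` anticommute with `J`, so `c * κ` is
  -- complex linear; its determinant `-(-1)^(mk)` must be nonnegative.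
  let Q : Matrix (Fin m ⊕ Fin m) (Fin m ⊕ Fin m) ℝ := Matrix.fromBlocks 1 0 0 (-1)
  obtain ⟨κ, hκ⟩ := EquivLike.surjective (LinearMap.toMatrixOrthonormal w)
    (Q ⊗ₖ (1 : Matrix (Fin k) (Fin k) ℝ))
  have hF : Howe.fieldRestriction (Complex.I • (1 : Matrix (Fin m) (Fin m) ℂ)) =
      Matrix.fromBlocks 0 1 (-1) 0 := by
    ext (i | i) (j | j) <;> simp [Howe.fieldRestriction, Matrix.one_apply] <;> split_ifs <;> simp
  have hκJ : κ * J = -(J * κ) := by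
    apply EquivLike.injective (LinearMap.toMatrixOrthonormal w)
    have hQ : Q * Matrix.fromBlocks 0 1 (-1) 0 =
        (-1 : ℝ) • (Matrix.fromBlocks 0 1 (-1) 0 * Q) := by
      simp [Q, Matrix.fromBlocks_multiply, Matrix.fromBlocks_neg]
    rw [map_neg, map_mul, map_mul, hκ, hwJ, ← Matrix.mul_kronecker_mul, ← Matrix.mul_kronecker_mul,
      hF, hQ, Matrix.smul_kronecker, neg_one_smul]
  have hpos := det_nonneg_of_commute (T := c * κ) hJ (by
    rw [mul_assoc, hκJ, mul_neg, ← mul_assoc, hcJ]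
    simp [mul_assoc])
  have hdκ : LinearMap.det κ = ((-1) ^ m) ^ k := by
    rw [← det_toMatrixOrthonormal w, hκ, Matrix.det_kronecker]
    simp [Q, Matrix.det_neg]
  rw [map_mul, hdet, hdκ, ← pow_mul] at hpos
  right
  refine ⟨m, k, ?_⟩
  have : Odd (m * k) := by
    by_contra hmk
    rw [(Nat.not_odd_iff_even.mp hmk).neg_one_pow] at hpos
    norm_num at hpos
  exact ⟨(Nat.odd_mul.mp this).1, (Nat.odd_mul.mp this).2, w, hw⟩

theorem IsDualPair.hasOddType [Nontrivial E] {A B : Subalgebra ℝ (End ℝ E)}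
    (h : IsDualPair A B) (hZ : IsFactor A B) {c : End ℝ E} (hc : star c * c = 1)
    (hcA : ∀ T, T ∈ A ↔ c * T * star c ∈ A) (hdet : LinearMap.det c = -1) : HasOddType A := by
  by_cases hskew : ∀ K ∈ A, K ∈ B → star K = -K → K = 0
  · have hZ' : ∀ z ∈ A, z ∈ B → ∃ μ : ℝ, z = μ • 1 := by
      intro z hzA hzB
      have hsA := h.star_left z hzA
      have hsB := h.star_right z hzB
      obtain ⟨μ, hμ⟩ := hZ (z + star z) (A.add_mem hzA hsA) (B.add_mem hzB hsB) (by simp [add_comm])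
      have h2 := hskew (z - star z) (A.sub_mem hzA hsA) (B.sub_mem hzB hsB) (by simp)
      refine ⟨2⁻¹ * μ, ?_⟩
      rw [mul_smul, ← hμ, ← sub_eq_zero.mp h2]
      module
    obtain ⟨x, hx, y, hy, hx1, hy1, rfl⟩ :=
      h.exists_mul_eq_of_normalizes hZ' hc fun a ha => (hcA a).mp ha
    rw [map_mul] at hdet
    have hxy : LinearMap.det x = -1 ∨ LinearMap.det y = -1 := by
      rcases det_eq_one_or_neg_one hx1 with h1 | h1
      · right; rwa [h1, one_mul] at hdet
      · exact Or.inl h1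
    rcases h.isRealType_or_exists_sq_eq_neg_one hZ with ⟨m, k, w, hw⟩ | ⟨L, hL, hL2⟩
    · exact Or.inl ⟨m, k, hw.odd hx hy hxy, w, hw.1⟩
    rcases h.symm.isRealType_or_exists_sq_eq_neg_one hZ.symm with ⟨m, k, w, hw⟩ | ⟨L', hL', hL2'⟩
    · exact Or.inl ⟨k, m, hw.swap.odd hx hy hxy, _, hw.swap.1⟩
    · have h1 := det_nonneg_of_commute hL2' (h.comm hx hL')
      have h2 := det_nonneg_of_commute hL2 (h.comm hL hy).symm
      have := mul_nonneg h1 h2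
      linarith
  · push Not at hskew
    obtain ⟨K, hKA, hKB, hKs, hK0⟩ := hskew
    obtain ⟨μ, hμ⟩ := hZ (K * K) (A.mul_mem hKA hKA) (B.mul_mem hKB hKB)
      (by rw [star_mul, hKs, neg_mul_neg])
    obtain ⟨r, hr⟩ := exists_smul_sq_eq_neg hKs hK0 hμ (star_one _) (mul_one _)
    exact h.hasOddType_of_skew hZ hc hcA hdet (A.smul_mem hKA r) (B.smul_mem hKB r) hr
      (by rw [star_smul, hKs]; simp)

theorem proj_eq_of_star_eq {V : Submodule ℝ E} {P : End ℝ E} (hP : star P = P)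
    (h₁ : ∀ x, P x ∈ V) (h₂ : ∀ x ∈ V, P x = x) : proj V = P := by
  have h3 : P * proj V = proj V := LinearMap.ext fun x => h₂ _ (proj_mem V x)
  have h4 := congrArg star h3
  rw [star_mul, star_proj, hP, proj_mul_eq_of_maps h₁] at h4
  exact h4.symm

/-! ### Restriction of a dual pair to a subspace -/

/-- The extension by zero of an endomorphism of a subspace. -/
noncomputable def extend (W : Submodule ℝ E) (T : End ℝ W) : End ℝ E :=
  W.subtype ∘ₗ T ∘ₗ (proj W).codRestrict W (proj_mem W)

theorem extend_apply (W : Submodule ℝ E) (T : End ℝ W) (x : E) :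
    extend W T x = T ⟨proj W x, proj_mem W x⟩ := rfl

theorem extend_coe (W : Submodule ℝ E) (T : End ℝ W) (x : W) : extend W T x = T x := by
  rw [extend_apply]
  congr 2
  exact Subtype.ext (proj_apply_of_mem x.2)

theorem extend_mul_proj (W : Submodule ℝ E) (T : End ℝ W) : extend W T * proj W = extend W T :=
  LinearMap.ext fun x => by
    rw [Module.End.mul_apply, extend_apply, extend_apply]
    congr 2
    exact Subtype.ext (proj_apply_of_mem (proj_mem W x))

theorem proj_mul_extend (W : Submodule ℝ E) (T : End ℝ W) : proj W * extend W T = extend W T :=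
  proj_mul_eq_of_maps fun _ => (T _).2

theorem eq_extend {W : Submodule ℝ E} {T : End ℝ W} {S : End ℝ E} (hS : S * proj W = S)
    (h : ∀ x : W, S x = T x) : S = extend W T := by
  rw [← hS]
  exact LinearMap.ext fun x => h ⟨proj W x, proj_mem W x⟩

theorem extend_mul (W : Submodule ℝ E) (S T : End ℝ W) :
    extend W (S * T) = extend W S * extend W T :=
  (eq_extend (by rw [mul_assoc, extend_mul_proj]) fun x => by
    rw [Module.End.mul_apply, extend_coe, extend_coe]; rfl).symm

theorem extend_one (W : Submodule ℝ E) : extend W 1 = proj W :=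
  (eq_extend (proj_mul_proj W) fun x => proj_apply_of_mem x.2).symm

theorem extend_smul (W : Submodule ℝ E) (r : ℝ) (T : End ℝ W) :
    extend W (r • T) = r • extend W T := rfl

theorem extend_injective (W : Submodule ℝ E) : Function.Injective (extend W) := fun S T h =>
  LinearMap.ext fun x => Subtype.ext (by rw [← extend_coe, h, extend_coe])

theorem extend_star (W : Submodule ℝ E) (T : End ℝ W) :
    extend W (star T) = star (extend W T) := by
  refine (eq_star_iff _ _).mpr fun x y => ?_
  rw [extend_apply, extend_apply]
  have e1 : ∀ (u : W) (z : E), ⟪(u : E), z⟫_ℝ = ⟪(u : E), proj W z⟫_ℝ := fun u z => by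
    rw [← inner_star_left, star_proj, proj_apply_of_mem u.2]
  have e2 : ∀ (u : W) (z : E), ⟪z, (u : E)⟫_ℝ = ⟪proj W z, (u : E)⟫_ℝ := fun u z => by
    rw [real_inner_comm, e1, real_inner_comm]
  rw [e1, e2]
  exact inner_star_left T ⟨_, proj_mem W x⟩ ⟨_, proj_mem W y⟩

/-- The extension by the identity preserves `W` and is trivial on the quotient by `W`. -/
theorem det_extend_add (W : Submodule ℝ E) (T : End ℝ W) :
    LinearMap.det (extend W T + (1 - proj W)) = LinearMap.det T := by
  set D := extend W T + (1 - proj W)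
  have hD : ∀ x : W, D x = T x := fun x => by
    simp [D, extend_coe, proj_apply_of_mem x.2]
  have hW : W ≤ W.comap D := fun x hx => by
    rw [Submodule.mem_comap, hD ⟨x, hx⟩]
    exact (T _).2
  rw [LinearMap.det_eq_det_mul_det W D hW]
  have h1 : D.restrict hW = T := LinearMap.ext fun x => Subtype.ext (hD x)
  have h2 : W.mapQ W D hW = LinearMap.id := by
    refine Submodule.linearMap_qext _ (LinearMap.ext fun x => ?_)
    simp only [LinearMap.comp_apply, Submodule.mapQ_apply, Submodule.mkQ_apply, LinearMap.id_apply]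
    rw [Submodule.Quotient.eq]
    have : D x - x = T ⟨proj W x, proj_mem W x⟩ - proj W x := by
      simp [D, extend_apply]; abel
    rw [this]
    exact W.sub_mem (T _).2 (proj_mem W x)
  rw [h1, h2, LinearMap.det_id, mul_one]

/-- The restriction of an algebra containing the projection onto `W` to `W`. -/
noncomputable def restr (A : Subalgebra ℝ (End ℝ E)) (W : Submodule ℝ E) (hW : proj W ∈ A) :
    Subalgebra ℝ (End ℝ W) where
  carrier := {T | extend W T ∈ A}
  mul_mem' hS hT := by
    rw [Set.mem_ofPred_eq, extend_mul]; exact A.mul_mem hS hT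
  add_mem' hS hT := A.add_mem hS hT
  algebraMap_mem' r := by
    rw [Set.mem_ofPred_eq, Algebra.algebraMap_eq_smul_one, extend_smul, extend_one]
    exact A.smul_mem hW r

theorem mem_restr {A : Subalgebra ℝ (End ℝ E)} {W : Submodule ℝ E} {hW : proj W ∈ A}
    {T : End ℝ W} : T ∈ restr A W hW ↔ extend W T ∈ A := Iff.rfl

namespace IsDualPair

variable {A B : Subalgebra ℝ (End ℝ E)}

/-- Each `b ∈ B` preserves `W`, and its restriction belongs to the restricted algebra, so commuting
with restrictions amounts to commuting with all of `B` after extension by zero. -/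
theorem mem_restr_iff (h : IsDualPair A B) {W : Submodule ℝ E} (hA : proj W ∈ A)
    (hB : proj W ∈ B) (T : End ℝ W) :
    T ∈ restr A W hA ↔ ∀ S ∈ restr B W hB, T * S = S * T := by
  constructor
  · intro hT S hS
    apply extend_injective
    rw [extend_mul, extend_mul]
    exact h.comm hT hS
  · intro H
    refine (h.mem_left _).mpr fun b hb => ?_
    have hbp : b * proj W = proj W * b := (h.comm hA hb).symm
    let S : End ℝ W := b.restrict fun x hx => mem_of_mul_proj_eq hbp hx
    have hS : b * proj W = extend W S :=
      eq_extend (by rw [mul_assoc, proj_mul_proj]) fun x => by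
        rw [Module.End.mul_apply, proj_apply_of_mem x.2]; rfl
    have hSB : S ∈ restr B W hB := by
      rw [mem_restr, ← hS]; exact B.mul_mem hb hB
    have h1 := congrArg (extend W) (H S hSB)
    rw [extend_mul, extend_mul, ← hS, mul_assoc, proj_mul_extend, hbp, ← mul_assoc,
      extend_mul_proj] at h1
    exact h1

theorem restr (h : IsDualPair A B) {W : Submodule ℝ E} (hA : proj W ∈ A) (hB : proj W ∈ B) :
    IsDualPair (restr A W hA) (restr B W hB) where
  mem_left := h.mem_restr_iff hA hB
  mem_right T := (h.symm.mem_restr_iff hB hA T).trans (by simp only [eq_comm])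
  star_left T hT := by
    rw [mem_restr, extend_star]; exact h.star_left _ hT
  star_right T hT := by
    rw [mem_restr, extend_star]; exact h.star_right _ hT

/-! ### The irreducible subspaces of a dual pair -/

theorem proj_mem_left_of_irr (h : IsDualPair A B) {W : Submodule ℝ E}
    (hW : Irr ((A : Set (End ℝ E)) ∪ B) W) : proj W ∈ A :=
  h.proj_mem_left fun T hT => hW.1 T (Or.inr hT)

theorem proj_mem_right_of_irr (h : IsDualPair A B) {W : Submodule ℝ E}
    (hW : Irr ((A : Set (End ℝ E)) ∪ B) W) : proj W ∈ B :=
  h.symm.proj_mem_left fun T hT => hW.1 T (Or.inl hT)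

theorem isFactor_restr (h : IsDualPair A B) {W : Submodule ℝ E}
    (hW : Irr ((A : Set (End ℝ E)) ∪ B) W) :
    IsFactor (RealDualPair.restr A W (h.proj_mem_left_of_irr hW))
      (RealDualPair.restr B W (h.proj_mem_right_of_irr hW)) := by
  intro z hzA hzB hz
  obtain ⟨μ, hμ⟩ := hW.exists_scalar (s := extend W z) (by rw [← extend_star, hz])
    (by
      rintro T (hT | hT)
      · exact h.comm hT hzB
      · exact (h.comm hzA hT).symm)
    (fun x hx => by rw [← proj_mul_extend]; exact proj_mem W _)
  refine ⟨μ, LinearMap.ext fun x => Subtype.ext ?_⟩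
  rw [← extend_coe, hμ x x.2]
  rfl

/-- Distinct irreducible subspaces meet trivially, and the product of their commuting projections
maps into the intersection. -/
theorem proj_mul_proj_eq_zero (h : IsDualPair A B) {W W' : Submodule ℝ E}
    (hW : Irr ((A : Set (End ℝ E)) ∪ B) W) (hW' : Irr ((A : Set (End ℝ E)) ∪ B) W')
    (hne : W ≠ W') : proj W * proj W' = 0 := by
  have hinf : W ⊓ W' = ⊥ := by
    rcases hW.2.2 _ inf_le_left (hW.1.inf hW'.1) with h1 | h1
    · exact h1
    · rcases hW'.2.2 _ inf_le_right (hW.1.inf hW'.1) with h2 | h2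
      · exact h2
      · exact absurd (h1.symm.trans h2) hne
  refine LinearMap.ext fun x => ?_
  have : (proj W * proj W') x ∈ W ⊓ W' := by
    refine ⟨proj_mem W _, ?_⟩
    rw [h.comm (h.proj_mem_left_of_irr hW) (h.proj_mem_right_of_irr hW')]
    exact proj_mem W' _
  rw [hinf] at this
  simpa using this

/-- The orthogonal complement of the sum is stable, so if nonzero it would contain a further
irreducible subspace. -/
theorem sSup_irr (h : IsDualPair A B) : sSup {W | Irr ((A : Set (End ℝ E)) ∪ B) W} = ⊤ := by
  set U := sSup {W | Irr ((A : Set (End ℝ E)) ∪ B) W} with hU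
  have hstU : Stable ((A : Set (End ℝ E)) ∪ B) U := by
    intro T hT
    change U ≤ U.comap T
    refine sSup_le fun W hW x hx => ?_
    exact (le_sSup hW : W ≤ U) (hW.1 T hT x hx)
  have hst : Stable ((A : Set (End ℝ E)) ∪ B) Uᗮ := by
    intro T hT x hx
    have hT' : star T ∈ (A : Set (End ℝ E)) ∪ B := by
      rcases hT with hT | hT
      · exact Or.inl (h.star_left T hT)
      · exact Or.inr (h.star_right T hT)
    rw [Submodule.mem_orthogonal] at hx ⊢
    intro u hu
    rw [← inner_star_left]
    exact hx _ (hstU _ hT' u hu)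
  by_contra hne
  obtain ⟨W, hWU, hW⟩ := exists_irr_le hst (fun h0 => hne ((Submodule.orthogonal_eq_bot_iff).mp h0))
  refine hW.2.1 ((Submodule.eq_bot_iff _).mpr fun x hx => ?_)
  have h1 : x ∈ U := (le_sSup hW : W ≤ U) hx
  have h2 := (Submodule.mem_orthogonal _ _).mp (hWU hx) x h1
  simpa using h2

end IsDualPair

/-- The orthogonal endomorphism `c` normalizes `A`. -/
structure Normalizes (c : End ℝ E) (A : Subalgebra ℝ (End ℝ E)) : Prop where
  orth : star c * c = 1
  conj : ∀ a ∈ A, c * a * star c ∈ A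
  conj_star : ∀ a ∈ A, star c * a * c ∈ A

namespace Normalizes

variable {A B : Subalgebra ℝ (End ℝ E)} {c d : End ℝ E}

theorem orth' (h : Normalizes c A) : c * star c = 1 := mul_star_eq_one h.orth

theorem star (h : Normalizes c A) : Normalizes (star c) A where
  orth := by rw [star_star]; exact h.orth'
  conj a ha := by rw [star_star]; exact h.conj_star a ha
  conj_star a ha := by rw [star_star]; exact h.conj a ha

theorem mul (hc : Normalizes c A) (hd : Normalizes d A) : Normalizes (c * d) A where
  orth := by
    rw [star_mul, mul_assoc, ← mul_assoc (Star.star c), hc.orth, one_mul, hd.orth]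
  conj a ha := by
    have := hc.conj _ (hd.conj a ha)
    simpa only [star_mul, mul_assoc] using this
  conj_star a ha := by
    have := hd.conj_star _ (hc.conj_star a ha)
    simpa only [star_mul, mul_assoc] using this

theorem mem_iff (h : Normalizes c A) (T : End ℝ E) : T ∈ A ↔ c * T * Star.star c ∈ A := by
  refine ⟨h.conj T, fun hT => ?_⟩
  have := h.conj_star _ hT
  have e : Star.star c * (c * T * Star.star c) * c = (Star.star c * c) * T * (Star.star c * c) := by
    simp only [mul_assoc]
  rwa [e, h.orth, one_mul, mul_one] at this

theorem right (h : Normalizes c A) (hAB : IsDualPair A B) : Normalizes c B where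
  orth := h.orth
  conj T hT := (hAB.conj_mem_right h.orth h.mem_iff T).mp hT
  conj_star T hT := by
    have := (hAB.conj_mem_right h.star.orth h.star.mem_iff T).mp hT
    rwa [star_star] at this

/-- The sum of the irreducible subspaces of the dual pair which `c` fixes pointwise. -/
def fixed (A B : Subalgebra ℝ (End ℝ E)) (c : End ℝ E) : Submodule ℝ E :=
  sSup {W | Irr ((A : Set (End ℝ E)) ∪ B) W ∧ ∀ x ∈ W, c x = x}

/-- Strictness holds because `c` is the identity on all of `fixed A B c`, which therefore cannot
contain `W`. -/
theorem fixed_lt {W : Submodule ℝ E} (hW : Irr ((A : Set (End ℝ E)) ∪ B) W)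
    (hc : ¬ ∀ x ∈ W, c x = x) (hd : ∀ x ∈ W, d x = x)
    (hcd : ∀ W', Irr ((A : Set (End ℝ E)) ∪ B) W' → W' ≠ W → (∀ x ∈ W', c x = x) →
      ∀ x ∈ W', d x = x) : fixed A B c < fixed A B d := by
  refine lt_of_le_not_ge (sSup_le fun W' hW' => le_sSup ⟨hW'.1, hcd W' hW'.1 ?_ hW'.2⟩) fun hle => ?_
  · rintro rfl
    exact hc hW'.2
  · have h1 : W ≤ fixed A B c := (le_sSup ⟨hW, hd⟩ : W ≤ fixed A B d).trans hle
    have h2 : fixed A B c ≤ LinearMap.ker (c - 1) := sSup_le fun W' hW' x hx => by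
      simp [hW'.2 x hx]
    refine hc fun x hx => ?_
    have := h2 (h1 hx)
    simpa [sub_eq_zero] using this

/-- The central projection `p` splits `A` into two ideals; the modified map conjugates by `c` on one
and acts trivially on the other. -/
theorem restrict_one (h : Normalizes c A) {p : End ℝ E} (hpA : p ∈ A)
    (hcomm : ∀ a ∈ A, a * p = p * a) (hps : Star.star p = p) (hp : p * p = p)
    (hcp : c * p = p * c) : Normalizes (c * (1 - p) + p) A := by
  have key : ∀ c : End ℝ E, Normalizes c A → c * p = p * c → ∀ a ∈ A,
      (c * (1 - p) + p) * a * (Star.star c * (1 - p) + p) ∈ A := by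
    intro c hc hcp a ha
    have hcp' : Star.star c * p = p * Star.star c := by
      have := congrArg Star.star hcp
      rw [star_mul, star_mul, hps] at this
      exact this.symm
    have e : (c * (1 - p) + p) * a * (Star.star c * (1 - p) + p) =
        (c * a * Star.star c) * (1 - p) + a * p := by
      have e1 : (1 - p) * a * (Star.star c * (1 - p)) = a * Star.star c * (1 - p) := by
        have : (1 - p) * a = a * (1 - p) := by rw [sub_mul, mul_sub, hcomm a ha, one_mul, mul_one]
        rw [this, mul_assoc, ← mul_assoc (1 - p)]
        have : (1 - p) * Star.star c = Star.star c * (1 - p) := by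
          rw [sub_mul, mul_sub, hcp', one_mul, mul_one]
        rw [this, mul_assoc, mul_assoc]
        congr 2
        simp [mul_sub, sub_mul, hp]
      have e2 : (1 - p) * a * p = 0 := by
        rw [mul_assoc, hcomm a ha, ← mul_assoc, sub_mul, hp, one_mul, sub_self, zero_mul]
      have e3 : p * a * (Star.star c * (1 - p)) = 0 := by
        rw [← hcomm a ha, mul_assoc, ← mul_assoc p, ← hcp', mul_assoc (Star.star c), mul_sub, hp,
          mul_one, sub_self, mul_zero, mul_zero]
      have e4 : p * a * p = a * p := by rw [← hcomm a ha, mul_assoc, hp]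
      calc _ = c * ((1 - p) * a * (Star.star c * (1 - p))) + c * ((1 - p) * a * p) +
            p * a * (Star.star c * (1 - p)) + p * a * p := by noncomm_ring
        _ = _ := by rw [e1, e2, e3, e4]; simp [mul_assoc]
    rw [e]
    exact A.add_mem (A.mul_mem (hc.conj a ha) (A.sub_mem A.one_mem hpA)) (A.mul_mem ha hpA)
  have hcp' : Star.star c * p = p * Star.star c := by
    have := congrArg Star.star hcp
    rw [star_mul, star_mul, hps] at this
    exact this.symm
  have hst : Star.star (c * (1 - p) + p) = Star.star c * (1 - p) + p := by
    rw [star_add, star_mul, star_sub, star_one, hps, sub_mul, mul_sub, hcp', one_mul, mul_one]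
  refine ⟨?_, fun a ha => ?_, fun a ha => ?_⟩
  · rw [hst]
    have e1 : (1 - p) * c = c * (1 - p) := by rw [sub_mul, mul_sub, hcp, one_mul, mul_one]
    have e2 : (1 - p) * (1 - p) = 1 - p := by simp [mul_sub, sub_mul, hp]
    have e3 : (1 - p) * p = 0 := by simp [sub_mul, hp]
    have e4 : p * c * (1 - p) = 0 := by
      rw [mul_assoc, ← e1, ← mul_assoc, mul_sub, hp, mul_one, sub_self, zero_mul]
    calc (Star.star c * (1 - p) + p) * (c * (1 - p) + p) =
          Star.star c * ((1 - p) * c) * (1 - p) + Star.star c * ((1 - p) * p) + p * c * (1 - p) +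
            p * p := by noncomm_ring
      _ = (Star.star c * c) * ((1 - p) * (1 - p)) + p := by
          rw [e1, e3, e4, hp]; simp [mul_assoc]
      _ = 1 := by rw [h.orth, e2]; simp
  · rw [hst]; exact key c h hcp a ha
  · rw [hst]
    have := key _ h.star hcp' a ha
    rwa [star_star] at this

end Normalizes

/-! ### Orientation-reversing normalizers and irreducible subspaces. -/

variable {A B : Subalgebra ℝ (End ℝ E)} {c : End ℝ E}

theorem proj_map {c : End ℝ E} (hc : star c * c = 1) (W : Submodule ℝ E) :
    proj (W.map c) = c * proj W * star c := by
  refine proj_eq_of_star_eq (by simp [star_proj, mul_assoc]) (fun x => ?_) ?_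
  · exact Submodule.mem_map_of_mem (proj_mem W _)
  · rintro _ ⟨x, hx, rfl⟩
    rw [← Module.End.mul_apply, mul_assoc, hc, mul_one, Module.End.mul_apply, proj_apply_of_mem hx]

theorem irr_map (hc : Normalizes c A) (h : IsDualPair A B) {W : Submodule ℝ E}
    (hW : Irr ((A : Set (End ℝ E)) ∪ B) W) : Irr ((A : Set (End ℝ E)) ∪ B) (W.map c) := by
  have hst : ∀ {c : End ℝ E}, Normalizes c A → ∀ U : Submodule ℝ E,
      Stable ((A : Set (End ℝ E)) ∪ B) U → Stable ((A : Set (End ℝ E)) ∪ B) (U.map c) := by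
    rintro c hc U hU T hT _ ⟨x, hx, rfl⟩
    have hT' : star c * T * c ∈ (A : Set (End ℝ E)) ∪ B := by
      rcases hT with hT | hT
      · exact Or.inl (hc.conj_star T hT)
      · exact Or.inr ((hc.right h).conj_star T hT)
    refine ⟨_, hU _ hT' x hx, ?_⟩
    rw [← Module.End.mul_apply, ← mul_assoc, ← mul_assoc, hc.orth', one_mul]
    rfl
  have hmm : ∀ {c : End ℝ E}, star c * c = 1 → ∀ U : Submodule ℝ E,
      (U.map c).map (star c) = U := fun {c} hc U => by
    rw [← Submodule.map_comp]
    have : star c ∘ₗ c = LinearMap.id := hc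
    rw [this, Submodule.map_id]
  refine ⟨hst hc W hW.1, fun h0 => hW.2.1 ?_, fun U hU hUst => ?_⟩
  · rw [← hmm hc.orth W, h0, Submodule.map_bot]
  · have hU' : (U.map (star c)).map c = U := by
      have := hmm hc.star.orth U
      rwa [star_star] at this
    have hle : U.map (star c) ≤ W := by
      rw [← hmm hc.orth W]; exact Submodule.map_mono hU
    rcases hW.2.2 _ hle (hst hc.star U hUst) with h1 | h1
    · left; rw [← hU', h1, Submodule.map_bot]
    · right; rw [← hU', h1]

theorem det_one_sub_two_smul_proj (K : Submodule ℝ E) :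
    LinearMap.det (1 - (2 : ℝ) • proj K) = (-1) ^ finrank ℝ K := by
  have h := Submodule.det_reflection (𝕜 := ℝ) Kᗮ
  rw [Submodule.orthogonal_orthogonal] at h
  rw [← h]
  congr 1
  refine LinearMap.ext fun x => ?_
  have : Kᗮ.starProjection x = x - K.starProjection x := by
    have := K.starProjection_add_starProjection_orthogonal x
    rw [eq_sub_iff_add_eq, add_comm]
    exact this
  change x - (2 : ℝ) • K.starProjection x = Kᗮ.reflection x
  rw [Submodule.reflection_apply, this]
  module

/-- The orthogonal involution which exchanges `W` with its image under `c` by means of `c`. -/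
theorem exists_swap (h : IsDualPair A B) (hc : Normalizes c A) {W : Submodule ℝ E}
    (hW : Irr ((A : Set (End ℝ E)) ∪ B) W) (hcW : W.map c ≠ W) (heven : Even (finrank ℝ W)) :
    ∃ s : End ℝ E, Normalizes s A ∧ LinearMap.det s = 1 ∧ (∀ x ∈ W, s (c x) = x) ∧
      ∀ x, proj W x = 0 → proj (W.map c) x = 0 → s x = x := by
  have hW' := irr_map hc h hW
  set p := proj W with hp
  set p' := proj (W.map c) with hp'
  have hp'c : p' = c * p * star c := proj_map hc.orth W
  have hps : star p = p := star_proj W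
  have hps' : star p' = p' := star_proj _
  have hpp : p * p = p := proj_mul_proj W
  have hpp' : p' * p' = p' := proj_mul_proj _
  have hpA : p ∈ A := h.proj_mem_left_of_irr hW
  have hpA' : p' ∈ A := h.proj_mem_left_of_irr hW'
  have hpB : p ∈ B := h.proj_mem_right_of_irr hW
  have hpB' : p' ∈ B := h.proj_mem_right_of_irr hW'
  have h0 : p' * p = 0 := h.proj_mul_proj_eq_zero hW' hW hcW
  have h0' : p * p' = 0 := h.proj_mul_proj_eq_zero hW hW' hcW.symm
  have hcp : p' * c = c * p := by
    rw [hp'c, mul_assoc, hc.orth, mul_one]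
  have hcp' : star c * p' = p * star c := by
    rw [hp'c, ← mul_assoc, ← mul_assoc, hc.orth, one_mul]
  set r := 1 - p - p' with hr
  have hrA : r ∈ A := A.sub_mem (A.sub_mem A.one_mem hpA) hpA'
  -- `s` is `c` on `W`, the inverse of `c` on the image of `W`, and the identity on the orthogonal
  -- complement of both.
  set s := c * p + p * star c + r with hs
  have hpr : p * r = 0 := by rw [hr, mul_sub, mul_sub, mul_one, hpp, h0', sub_self, sub_zero]
  have hpr' : p' * r = 0 := by rw [hr, mul_sub, mul_sub, mul_one, hpp', h0]; simp
  have hrr : r * r = r := by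
    conv_lhs => rw [hr, sub_mul, sub_mul, hpr, hpr', one_mul, sub_zero, sub_zero]
  have hrs : star r = r := by rw [hr]; simp [hps, hps']
  have hss : star s = s := by rw [hs]; simp [hps, hrs, add_comm]
  have hrp : r * p = 0 := by
    have := congrArg star hpr
    rwa [star_mul, hrs, hps, star_zero] at this
  have hpcp : p * c * p = 0 := by
    rw [mul_assoc, ← hcp, ← mul_assoc, h0', zero_mul]
  have hps_mul : p * s = p * star c := by
    rw [hs, mul_add, mul_add, hpr, ← mul_assoc, hpcp, ← mul_assoc, hpp]; simp
  have hps_mul' : p' * s = c * p := by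
    rw [hs, mul_add, mul_add, hpr', ← mul_assoc, hcp, mul_assoc, hpp, ← mul_assoc, h0]; simp
  have hrs_mul : r * s = r := by
    have hrp' : r * p' = 0 := by
      have := congrArg star hpr'
      rwa [star_mul, hrs, hps', star_zero] at this
    rw [hs, mul_add, mul_add, hrr, ← mul_assoc r p, hrp, ← hcp, ← mul_assoc, hrp']; simp
  have hsp : s * p = c * p := by
    have := congrArg star hps_mul
    rwa [star_mul, star_mul, hss, hps, star_star] at this
  have hsp' : s * p' = p * star c := by
    have := congrArg star hps_mul'
    rwa [star_mul, star_mul, hss, hps, hps'] at this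
  have hsr : s * r = r := by
    have := congrArg star hrs_mul
    rwa [star_mul, hss, hrs] at this
  have hone : (1 : End ℝ E) = p + p' + r := by rw [hr]; abel
  have hs1 : s * s = 1 := by
    calc s * s = s * (p + p' + r) * s := by rw [← hone, mul_one]
      _ = s * p * (p * s) + s * p' * (p' * s) + s * r * (r * s) := by
          simp only [mul_add, add_mul, mul_assoc]
          rw [← mul_assoc p p, hpp, ← mul_assoc p' p', hpp', ← mul_assoc r r, hrr]
      _ = p' + p + r := by
          rw [hsp, hps_mul, hsp', hps_mul', hsr, hrs_mul, hrr]
          congr 2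
          · rw [hp'c, mul_assoc c p, ← mul_assoc p p, hpp, mul_assoc]
          · rw [mul_assoc, ← mul_assoc (star c), hc.orth, one_mul, hpp]
      _ = 1 := by rw [hone]; abel
  have hconj : ∀ a ∈ A, s * a * s ∈ A := by
    intro a ha
    have hap : a * p = p * (a * p) := by rw [← mul_assoc, ← h.comm ha hpB, mul_assoc, hpp]
    have hap' : a * p' = p' * (a * p') := by rw [← mul_assoc, ← h.comm ha hpB', mul_assoc, hpp']
    have har : a * r = r * (a * r) := by
      have : a * r = r * a := h.comm ha (B.sub_mem (B.sub_mem B.one_mem hpB) hpB')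
      rw [← mul_assoc, ← this, mul_assoc, hrr]
    have e : s * a * s = c * (p * a) * star c + star c * (p' * a) * c + r * (a * r) := by
      calc s * a * s = s * (a * (p + p' + r)) * s := by rw [← hone, mul_one]
        _ = s * (a * p) * s + s * (a * p') * s + s * (a * r) * s := by
            simp only [mul_add, add_mul]
        _ = (s * p) * a * (p * s) + (s * p') * a * (p' * s) + (s * r) * a * (r * s) := by
            rw [hap, hap', har]; simp only [mul_assoc]
        _ = _ := by
            rw [hsp, hps_mul, hsp', hps_mul', hsr, hrs_mul, mul_assoc r a r]
            congr 2
            · rw [mul_assoc, mul_assoc, ← mul_assoc a, h.comm ha hpB]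
              simp only [mul_assoc]
              rw [← mul_assoc p p, hpp]
            · rw [← hcp', ← hcp]
              simp only [mul_assoc]
              rw [← mul_assoc a p', h.comm ha hpB', mul_assoc, ← mul_assoc p' p', hpp']
    rw [e]
    exact A.add_mem (A.add_mem (hc.conj _ (A.mul_mem hpA ha)) (hc.conj_star _ (A.mul_mem hpA' ha)))
      (A.mul_mem hrA (A.mul_mem ha hrA))
  have hpx : ∀ x ∈ W, p x = x := fun x hx => proj_apply_of_mem hx
  have hscx : ∀ x ∈ W, s (c x) = x := by
    intro x hx
    have h1 : c x = (p' * c) x := by rw [hcp, Module.End.mul_apply, hpx x hx]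
    rw [h1, ← Module.End.mul_apply, ← mul_assoc, hsp', mul_assoc, hc.orth, mul_one, hpx x hx]
  have hsx : ∀ x ∈ W, s x = c x := by
    intro x hx
    rw [← hpx x hx, ← Module.End.mul_apply, hsp, Module.End.mul_apply, hpx x hx]
  refine ⟨s, ⟨by rw [hss, hs1], fun a ha => by rw [hss]; exact hconj a ha,
    fun a ha => by rw [hss]; exact hconj a ha⟩, ?_, hscx, fun x hx hx' => ?_⟩
  -- The -1 eigenspace of `s` is the set of all `x - c x` with `x ∈ W`. It has the dimension of `W`,
  -- which is even, so `det s = 1`.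
  · let K := W.map (1 - c)
    have hK : proj K = (2⁻¹ : ℝ) • (1 - s) := by
      refine proj_eq_of_star_eq (by simp [hss]) (fun x => ?_) ?_
      · have e : 1 - s = (1 - c) * (p - p * star c) := by
          have : c * (p * star c) = p' := by rw [hp'c, mul_assoc]
          rw [sub_mul, one_mul, mul_sub, this, hs, hr]
          abel
        rw [e]
        exact K.smul_mem _ (Submodule.mem_map_of_mem (W.sub_mem (proj_mem W _) (proj_mem W _)))
      · rintro _ ⟨x, hx, rfl⟩
        simp only [LinearMap.smul_apply, LinearMap.sub_apply, Module.End.one_apply, map_sub,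
          hscx x hx, hsx x hx]
        module
    have hs2 : s = 1 - (2 : ℝ) • proj K := by rw [hK]; module
    have hdim : finrank ℝ K = finrank ℝ W := by
      have hinj : Function.Injective ((1 - c) ∘ₗ W.subtype) := by
        rw [← LinearMap.ker_eq_bot, LinearMap.ker_eq_bot']
        rintro ⟨x, hx⟩ hx0
        have hcx : x = c x := by simpa [sub_eq_zero] using hx0
        have h1 : p' x = x := by
          conv_lhs => rw [hcx, ← Module.End.mul_apply, hcp, Module.End.mul_apply, hpx x hx, ← hcx]
        have h2 : (p * p') x = x := by rw [Module.End.mul_apply, h1, hpx x hx]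
        rw [h0', LinearMap.zero_apply] at h2
        exact Subtype.ext h2.symm
      have := LinearMap.finrank_range_of_inj hinj
      rwa [LinearMap.range_comp, Submodule.range_subtype] at this
    rw [hs2, det_one_sub_two_smul_proj, hdim, heven.neg_one_pow]
  · have e : s x = s ((p + p' + r) x) := by rw [← hone, Module.End.one_apply]
    have hrx : r x = x := by
      change x - p x - p' x = x
      rw [hx, hx', sub_zero, sub_zero]
    have hx1 : (p + p' + r) x = r x := by
      change p x + p' x + r x = r x
      rw [hx, hx', zero_add, zero_add]
    rw [e, hx1, ← Module.End.mul_apply, hsr, hrx]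

theorem IsDualPair.hasOddType_restr (h : IsDualPair A B) {W : Submodule ℝ E}
    (hW : Irr ((A : Set (End ℝ E)) ∪ B) W) (hc : Normalizes c A) (hcW : ∀ x ∈ W, c x ∈ W)
    (hdet : LinearMap.det (c.restrict hcW) = -1) :
    HasOddType (RealDualPair.restr A W (h.proj_mem_left_of_irr hW)) := by
  have hpB := h.proj_mem_right_of_irr hW
  have hpA := h.proj_mem_left_of_irr hW
  have : Nontrivial W := Submodule.nontrivial_iff_ne_bot.mpr hW.2.1
  have hext : extend W (c.restrict hcW) = c * proj W :=
    (eq_extend (by rw [mul_assoc, proj_mul_proj]) fun x => by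
      rw [Module.End.mul_apply, proj_apply_of_mem x.2]; rfl).symm
  have hconj : ∀ T : End ℝ W, extend W (c.restrict hcW * T * star (c.restrict hcW)) =
      c * extend W T * star c := by
    intro T
    rw [extend_mul, extend_mul, extend_star, hext, star_mul, star_proj, mul_assoc c,
      proj_mul_extend, mul_assoc, ← mul_assoc (extend W T), extend_mul_proj, mul_assoc]
  refine (h.restr hpA hpB).hasOddType (h.isFactor_restr hW) (c := c.restrict hcW) ?_ ?_ hdet
  · apply extend_injective
    rw [extend_mul, extend_star, hext, extend_one, star_mul, star_proj, mul_assoc,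
      ← mul_assoc (star c), hc.orth, one_mul, proj_mul_proj]
  · intro T
    rw [mem_restr, mem_restr, hconj]
    exact hc.mem_iff _

/-- A dual pair whose normalizer contains orientation reversing elements has an irreducible
subspace of odd type. -/
theorem IsDualPair.exists_irr_hasOddType (h : IsDualPair A B) (hc : Normalizes c A)
    (hdet : LinearMap.det c = -1) : ∃ (W : Submodule ℝ E)
    (hW : Irr ((A : Set (End ℝ E)) ∪ B) W),
      HasOddType (RealDualPair.restr A W (h.proj_mem_left_of_irr hW)) := by
  by_cases hodd : ∃ W : Submodule ℝ E, Irr ((A : Set (End ℝ E)) ∪ B) W ∧ Odd (finrank ℝ W)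
  -- The scalar -1 normalizes everything and reverses orientation on an odd-dimensional subspace.
  · obtain ⟨W, hW, hWodd⟩ := hodd
    refine ⟨W, hW, h.hasOddType_restr hW (c := -1)
      ⟨by simp, fun a ha => by simpa using ha, fun a ha => by simpa using ha⟩
      (fun x hx => by simpa using hx) ?_⟩
    have : (-1 : End ℝ E).restrict (fun x hx => by simpa using hx) = (-1 : ℝ) • (1 : End ℝ W) :=
      LinearMap.ext fun x => Subtype.ext (by simp [LinearMap.restrict_apply])
    rw [this, LinearMap.det_smul, hWodd.neg_one_pow]
    simp
  push Not at hodd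
  -- Among the normalizing elements of determinant -1, choose one whose pointwise fixed irreducible
  -- subspaces have maximal sum.
  obtain ⟨F, ⟨c, hc, hdet, rfl⟩, hmax⟩ :=
    (wellFounded_gt (α := Submodule ℝ E)).has_min
      {F | ∃ c, Normalizes c A ∧ LinearMap.det c = -1 ∧ F = Normalizes.fixed A B c}
      ⟨_, c, hc, hdet, rfl⟩
  have hmax : ∀ d, Normalizes d A → LinearMap.det d = -1 →
      ¬ Normalizes.fixed A B c < Normalizes.fixed A B d := fun d hd hd' =>
    hmax _ ⟨d, hd, hd', rfl⟩
  obtain ⟨W, hW, hWc⟩ : ∃ W, Irr ((A : Set (End ℝ E)) ∪ B) W ∧ ¬ ∀ x ∈ W, c x = x := by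
    by_contra! H
    have h1 : (⊤ : Submodule ℝ E) ≤ LinearMap.ker (c - 1) := by
      rw [← h.sSup_irr]
      exact sSup_le fun W hW x hx => by simp [H W hW x hx]
    have h2 : c = 1 := LinearMap.ext fun x => by
      have := h1 (Submodule.mem_top (x := x))
      simpa [sub_eq_zero] using this
    rw [h2, map_one] at hdet
    norm_num at hdet
  have hpA := h.proj_mem_left_of_irr hW
  have hpB := h.proj_mem_right_of_irr hW
  by_cases hcW : W.map c = W
  · have hcW' : ∀ x ∈ W, c x ∈ W := fun x hx => by
      have := Submodule.mem_map_of_mem (f := c) hx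
      rwa [hcW] at this
    refine ⟨W, hW, h.hasOddType_restr hW hc hcW' ?_⟩
    have hcp : c * proj W = proj W * c := by
      have := proj_map hc.orth W
      rw [hcW] at this
      conv_rhs => rw [this, mul_assoc, hc.orth, mul_one]
    have hext : extend W (c.restrict hcW') = c * proj W :=
      (eq_extend (by rw [mul_assoc, proj_mul_proj]) fun x => by
        rw [Module.End.mul_apply, proj_apply_of_mem x.2]; rfl).symm
    have hd := hc.restrict_one hpA (fun a ha => h.comm ha hpB) (star_proj W) (proj_mul_proj W) hcp
    set d := c * (1 - proj W) + proj W with hd_def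
    have hmul : c = (extend W (c.restrict hcW') + (1 - proj W)) * d := by
      have e1 : (1 - proj W) * c = c * (1 - proj W) := by
        rw [sub_mul, mul_sub, hcp, one_mul, mul_one]
      have e2 : (1 - proj W) * (1 - proj W) = 1 - proj W := by simp [mul_sub, sub_mul, proj_mul_proj]
      have e3 : (1 - proj W) * proj W = 0 := by simp [sub_mul, proj_mul_proj]
      have e4 : proj W * (1 - proj W) = 0 := by simp [mul_sub, proj_mul_proj]
      rw [hext, hd_def]
      symm
      calc (c * proj W + (1 - proj W)) * (c * (1 - proj W) + proj W) =
          c * (proj W * c) * (1 - proj W) + c * (proj W * proj W) +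
            ((1 - proj W) * c) * (1 - proj W) + (1 - proj W) * proj W := by noncomm_ring
        _ = c * c * (proj W * (1 - proj W)) + c * proj W + c * ((1 - proj W) * (1 - proj W)) := by
            rw [← hcp, proj_mul_proj, e1, e3, add_zero]; simp only [mul_assoc]
        _ = c := by rw [e4, e2]; simp [mul_sub]
    -- If `det d` were -1, then `d`, which agrees with `c` off `W` and fixes `W`, would contradict
    -- maximality. So the sign of `det c` comes from `W`.
    have hdd : LinearMap.det d = 1 := by
      rcases det_eq_one_or_neg_one hd.orth with h1 | h1
      · exact h1
      · refine absurd (Normalizes.fixed_lt hW hWc (fun x hx => ?_) fun W' hW' hne hW'c x hx => ?_)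
          (hmax d hd h1)
        · simp [hd_def, proj_apply_of_mem hx]
        · have h0 : proj W x = 0 := by
            rw [← proj_apply_of_mem hx, ← Module.End.mul_apply,
              h.proj_mul_proj_eq_zero hW hW' hne.symm, LinearMap.zero_apply]
          simp [hd_def, h0, hW'c x hx]
    have := congrArg LinearMap.det hmul
    rw [map_mul, hdet, hdd, mul_one, det_extend_add] at this
    exact this.symm
  · exfalso
    obtain ⟨s, hs, hsdet, hsW, hsx⟩ :=
      exists_swap h hc hW hcW (Nat.not_odd_iff_even.mp (hodd W hW))
    -- Composing with the swap keeps the determinant, fixes `W`, and still fixes every irreducible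
    -- subspace that `c` fixed.
    refine hmax (s * c) (hs.mul hc) (by rw [map_mul, hsdet, hdet, one_mul])
      (Normalizes.fixed_lt hW hWc hsW fun W' hW' hne hW'c x hx => ?_)
    have hzero : ∀ {U : Submodule ℝ E}, Irr ((A : Set (End ℝ E)) ∪ B) U → U ≠ W' →
        proj U x = 0 := fun hU hUne => by
      rw [← proj_apply_of_mem hx, ← Module.End.mul_apply,
        h.proj_mul_proj_eq_zero hU hW' hUne, LinearMap.zero_apply]
    rw [Module.End.mul_apply, hW'c x hx]
    refine hsx x (hzero hW hne.symm) (hzero (irr_map hc h hW) ?_)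
    rintro rfl
    -- The image of `W` is not among the subspaces fixed by `c`: `c (c y) = c y` would give `c y =
    -- y` on `W`.
    refine hWc fun y hy => ?_
    have h1 := hW'c _ (Submodule.mem_map_of_mem hy)
    have h2 := congrArg (fun z => star c z) h1
    simp only [← Module.End.mul_apply] at h2
    rw [← mul_assoc, hc.orth] at h2
    simpa using h2

end RealDualPair

namespace Howe

open Module RealDualPair

variable {n : ℕ}

/-! ### Conjugation and centralizers -/

theorem centralizer_map {G : Type*} [Group G] (φ : G ≃* G) (K : Subgroup G) :
    Subgroup.centralizer ((K.map φ.toMonoidHom : Subgroup G) : Set G) =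
      (Subgroup.centralizer (K : Set G)).map φ.toMonoidHom := by
  ext x
  simp only [Subgroup.mem_centralizer_iff, Subgroup.mem_map, SetLike.mem_coe]
  constructor
  · intro h
    refine ⟨φ.symm x, fun y hy => φ.injective ?_, φ.apply_symm_apply x⟩
    have := h (φ y) ⟨y, hy, rfl⟩
    simpa using this
  · rintro ⟨y, hy, rfl⟩ _ ⟨z, hz, rfl⟩
    have := congrArg φ (hy z hz)
    simpa using this

theorem IsHowe.map {G : Type*} [Group G] {K : Subgroup G} (hK : IsHowe K) (φ : G ≃* G) :
    IsHowe (K.map φ.toMonoidHom) := by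
  rw [IsHowe, centralizer_map, centralizer_map, hK]

theorem isHowe_centralizer {G : Type*} [Group G] (s : Set G) :
    IsHowe (Subgroup.centralizer s) :=
  le_antisymm (Subgroup.centralizer_le fun x hx => Subgroup.mem_centralizer_iff.mpr fun _ hy =>
      (Subgroup.mem_centralizer_iff.mp hy x hx).symm)
    (Subgroup.le_centralizer_iff.mpr le_rfl)

theorem mem_conj {G : Type*} [Group G] {g x : G} {K : Subgroup G} :
    x ∈ conj g K ↔ g⁻¹ * x * g ∈ K := by
  simp only [conj, Subgroup.mem_map]
  constructor
  · rintro ⟨y, hy, rfl⟩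
    simpa [mul_assoc] using hy
  · intro h
    exact ⟨_, h, by simp [mul_assoc]⟩

theorem conj_mul {G : Type*} [Group G] (g h : G) (K : Subgroup G) :
    conj (g * h) K = conj g (conj h K) := by
  ext x; simp [mem_conj, mul_assoc]

theorem conj_one {G : Type*} [Group G] (K : Subgroup G) : conj 1 K = K := by
  ext x; simp [mem_conj]

theorem conjClass_conj {G : Type*} [Group G] (g : G) (K : Subgroup G) :
    conjClass (conj g K) = conjClass K := by
  ext L
  simp only [conjClass, Set.mem_range]
  constructor
  · rintro ⟨h, rfl⟩
    exact ⟨h * g, conj_mul _ _ _⟩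
  · rintro ⟨h, rfl⟩
    exact ⟨h * g⁻¹, by rw [← conj_mul, inv_mul_cancel_right]⟩

theorem incl_injective : Function.Injective (incl n) := fun _ _ h =>
  Subtype.ext (congrArg (fun z : O n => (z : Matrix (Fin n) (Fin n) ℝ)) h)

theorem det_incl (x : SO n) : (incl n x : Matrix (Fin n) (Fin n) ℝ).det = 1 :=
  (Matrix.mem_specialUnitaryGroup_iff.mp x.2).2

theorem exists_incl_eq {g : O n} (hg : (g : Matrix (Fin n) (Fin n) ℝ).det = 1) :
    ∃ x : SO n, incl n x = g :=
  ⟨⟨g, Matrix.mem_specialUnitaryGroup_iff.mpr ⟨g.2, hg⟩⟩, rfl⟩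

theorem det_mul (g h : O n) : ((g * h : O n) : Matrix (Fin n) (Fin n) ℝ).det =
    (g : Matrix (Fin n) (Fin n) ℝ).det * (h : Matrix (Fin n) (Fin n) ℝ).det :=
  Matrix.det_mul _ _

theorem det_inv (g : O n) : ((g⁻¹ : O n) : Matrix (Fin n) (Fin n) ℝ).det =
    (g : Matrix (Fin n) (Fin n) ℝ).det := by
  rw [Matrix.UnitaryGroup.inv_val, Matrix.star_eq_conjTranspose, Matrix.det_conjTranspose,
    star_trivial]

theorem det_eq_or (g : O n) : (g : Matrix (Fin n) (Fin n) ℝ).det = 1 ∨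
    (g : Matrix (Fin n) (Fin n) ℝ).det = -1 := by
  refine mul_self_eq_one_iff.mp ?_
  nth_rewrite 2 [← det_inv]
  rw [← det_mul, mul_inv_cancel]
  exact Matrix.det_one

theorem S_conj_incl (s : SO n) (K : Subgroup (O n)) : S (conj (incl n s) K) = conj s (S K) := by
  ext x; simp [S, mem_conj]

/-- The automorphism of `SO(n)` given by conjugation with an element of `O(n)`. -/
def conjSO (g : O n) : SO n ≃* SO n :=
  have key : ∀ (g : O n) (x : SO n), ((g * incl n x * g⁻¹ : O n) : Matrix (Fin n) (Fin n) ℝ) ∈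
      Matrix.specialOrthogonalGroup (Fin n) ℝ := fun g x =>
    Matrix.mem_specialUnitaryGroup_iff.mpr ⟨(g * incl n x * g⁻¹ : O n).2, by
      rw [det_mul, det_mul, det_incl, mul_one, ← det_mul, mul_inv_cancel]; exact Matrix.det_one⟩
  { toFun := fun x => ⟨_, key g x⟩
    invFun := fun x => ⟨_, key g⁻¹ x⟩
    left_inv := fun x => incl_injective (by
      change g⁻¹ * (g * incl n x * g⁻¹) * g⁻¹⁻¹ = incl n x
      group)
    right_inv := fun x => incl_injective (by
      change g * (g⁻¹ * incl n x * g⁻¹⁻¹) * g⁻¹ = incl n x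
      group)
    map_mul' := fun x y => incl_injective (by
      change g * incl n (x * y) * g⁻¹ = g * incl n x * g⁻¹ * (g * incl n y * g⁻¹)
      rw [map_mul]; group) }

theorem S_conj (g : O n) (K : Subgroup (O n)) :
    S (conj g K) = (S K).map (conjSO g).toMonoidHom := by
  ext x
  simp only [S, Subgroup.mem_comap, mem_conj, Subgroup.mem_map]
  constructor
  · intro h
    refine ⟨(conjSO g).symm x, ?_, (conjSO g).apply_symm_apply x⟩
    change g⁻¹ * incl n x * g⁻¹⁻¹ ∈ K
    rwa [inv_inv]
  · rintro ⟨y, hy, rfl⟩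
    change g⁻¹ * (g * incl n y * g⁻¹) * g ∈ K
    simpa [mul_assoc] using hy

/-- Conjugation by any element of `O(n)` is an automorphism of `SO(n)`, and automorphisms preserve
the double centralizer condition. -/
theorem isHowe_of_mem_inducedClasses {H : Subgroup (O n)} (hS : IsHowe (S H))
    {C : Set (Subgroup (SO n))} (hC : C ∈ inducedClasses H) {K : Subgroup (SO n)} (hK : K ∈ C) :
    IsHowe K := by
  obtain ⟨_, ⟨g, rfl⟩, rfl⟩ := hC
  obtain ⟨s, rfl⟩ := hK
  simp only [S_conj]
  exact (hS.map _).map _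

/-- The double centralizer of `S H` in `O(n)` is a Howe subgroup between `S H` and `H`, and
admissibility forbids it to be smaller than `H`. So `S H` determines `H`. -/
theorem centralizer_centralizer_S {H : Subgroup (O n)} (hH : IsSAdmissible H) :
    Subgroup.centralizer (Subgroup.centralizer (((S H).map (incl n) : Subgroup (O n)) :
      Set (O n)) : Set (O n)) = H := by
  have hle : (S H).map (incl n) ≤ H := Subgroup.map_comap_le _ _
  have h1 : Subgroup.centralizer (Subgroup.centralizer (((S H).map (incl n) : Subgroup (O n)) :
      Set (O n)) : Set (O n)) ≤ H := by
    conv_rhs => rw [← hH.1]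
    exact Subgroup.centralizer_le (Subgroup.centralizer_le hle)
  by_contra hne
  exact hH.2.2 ⟨_, isHowe_centralizer _, Subgroup.le_centralizer_iff.mpr le_rfl,
    lt_of_le_of_ne h1 hne⟩

theorem conj_eq_of_S_conj_eq {H : Subgroup (O n)} (hH : IsSAdmissible H) {g : O n}
    (hg : S (conj g H) = S H) : conj g H = H := by
  have h1 : ((S H).map (incl n)).map (MulAut.conj g).toMonoidHom = (S H).map (incl n) := by
    conv_rhs => rw [← hg, S_conj]
    rw [Subgroup.map_map, Subgroup.map_map]
    rfl
  conv_lhs => rw [← centralizer_centralizer_S hH]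
  rw [conj, ← centralizer_map, ← centralizer_map, h1, centralizer_centralizer_S hH]

theorem exists_reflection_matrix {m : ℕ} (hm : 0 < m) :
    ∃ D : Matrix (Fin m) (Fin m) ℝ, D.transpose = D ∧ D * D = 1 ∧ D.det = -1 := by
  let i₀ : Fin m := ⟨0, hm⟩
  refine ⟨Matrix.diagonal fun i => if i = i₀ then -1 else 1, Matrix.diagonal_transpose _, ?_, ?_⟩
  · rw [Matrix.diagonal_mul_diagonal, ← Matrix.diagonal_one]
    congr 1
    ext i
    split_ifs <;> simp
  · simp [Matrix.det_diagonal, Finset.prod_ite_eq']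

theorem exists_det_eq_neg_one (hn : 0 < n) :
    ∃ a : O n, (a : Matrix (Fin n) (Fin n) ℝ).det = -1 := by
  obtain ⟨D, hD, hDD, hdet⟩ := exists_reflection_matrix hn
  exact ⟨⟨D, (Matrix.mem_orthogonalGroup_iff _ _).mpr (by rw [hD, hDD])⟩, hdet⟩

/-- `O(n)` is the union of `SO(n)` and the coset `SO(n) a`, and conjugation by `SO(n)` does not
change the class. -/
theorem inducedClasses_eq (H : Subgroup (O n)) {a : O n}
    (ha : (a : Matrix (Fin n) (Fin n) ℝ).det = -1) :
    inducedClasses H = {conjClass (S H), conjClass (S (conj a H))} := by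
  ext C
  simp only [inducedClasses, Set.mem_insert_iff, Set.mem_singleton_iff, Set.mem_ofPred_eq]
  constructor
  · rintro ⟨_, ⟨g, rfl⟩, rfl⟩
    rcases det_eq_or g with hg | hg
    · obtain ⟨s, rfl⟩ := exists_incl_eq hg
      left
      simp only [S_conj_incl, conjClass_conj]
    · obtain ⟨s, hs⟩ := exists_incl_eq (g := g * a⁻¹) (by rw [det_mul, det_inv, hg, ha]; norm_num)
      right
      have : g = incl n s * a := by rw [hs, inv_mul_cancel_right]
      simp only [this, conj_mul, S_conj_incl, conjClass_conj]
  · rintro (rfl | rfl)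
    · exact ⟨H, ⟨1, conj_one H⟩, rfl⟩
    · exact ⟨_, ⟨a, rfl⟩, rfl⟩

/-- If `s ∈ SO(n)` conjugates `S H` to `S (conj a H)`, then `s⁻¹ * a` normalizes `S H`, hence `H`.
Conversely, `a` differs from a normalizing `g` of determinant -1 by an element of `SO(n)`. -/
theorem conjClass_eq_iff {H : Subgroup (O n)} (hH : IsSAdmissible H) {a : O n}
    (ha : (a : Matrix (Fin n) (Fin n) ℝ).det = -1) :
    conjClass (S H) = conjClass (S (conj a H)) ↔
      ∃ g : O n, (g : Matrix (Fin n) (Fin n) ℝ).det = -1 ∧ conj g H = H := by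
  constructor
  · intro h
    have : S (conj a H) ∈ conjClass (S H) := h ▸ ⟨1, conj_one _⟩
    obtain ⟨s, hs⟩ := this
    refine ⟨incl n s⁻¹ * a, by rw [det_mul, det_incl, ha, one_mul],
      conj_eq_of_S_conj_eq hH ?_⟩
    change conj s (S H) = _ at hs
    rw [conj_mul, S_conj_incl, ← hs, ← conj_mul, inv_mul_cancel, conj_one]
  · rintro ⟨g, hg, hgH⟩
    obtain ⟨s, hs⟩ := exists_incl_eq (g := a * g⁻¹) (by rw [det_mul, det_inv, hg, ha]; norm_num)
    have : a = incl n s * g := by rw [hs, inv_mul_cancel_right]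
    rw [this, conj_mul, S_conj_incl, conjClass_conj, hgH]

/-! ### The dual pair of a Howe subgroup -/

theorem act_mul (g h : O n) : act (g * h) = act g * act h := Matrix.toLpLin_mul_same _ _ _

theorem act_one : act (1 : O n) = 1 := Matrix.toLpLin_one _

theorem star_act (g : O n) : star (act g) = act g⁻¹ := by
  rw [LinearMap.star_eq_adjoint, act, ← Matrix.toEuclideanLin_conjTranspose_eq_adjoint]
  rfl

theorem star_act_mul_act (g : O n) : star (act g) * act g = 1 := by
  rw [star_act, ← act_mul, inv_mul_cancel, act_one]

theorem act_injective : Function.Injective (act (n := n)) := fun _ _ h =>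
  Subtype.ext (Matrix.toEuclideanLin.injective h)

theorem exists_act_eq {T : End ℝ (EuclideanSpace ℝ (Fin n))} (hT : star T * T = 1) :
    ∃ g : O n, act g = T := by
  let M := Matrix.toEuclideanLin.symm T
  have hM : Matrix.toEuclideanLin M = T := Matrix.toEuclideanLin.apply_symm_apply T
  refine ⟨⟨M, ?_⟩, hM⟩
  rw [Matrix.mem_orthogonalGroup_iff']
  apply Matrix.toEuclideanLin.injective
  rw [← Matrix.conjTranspose_eq_transpose_of_trivial]
  have h1 : Matrix.toEuclideanLin M.conjTranspose = star T := by
    rw [Matrix.toEuclideanLin_conjTranspose_eq_adjoint, hM, LinearMap.star_eq_adjoint]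
  have h2 := Matrix.toLpLin_mul_same 2 M.conjTranspose M
  have h3 := Matrix.toLpLin_one (n := Fin n) (R := ℝ) 2
  exact (h2.trans (by rw [h1, hM]; exact hT)).trans h3.symm

theorem det_act (g : O n) : LinearMap.det (act g) = (g : Matrix (Fin n) (Fin n) ℝ).det :=
  LinearMap.det_toLpLin _ _

/-- The commutant of the centralizer of `H`. -/
noncomputable def leftAlg (H : Subgroup (O n)) :
    Subalgebra ℝ (End ℝ (EuclideanSpace ℝ (Fin n))) :=
  Subalgebra.centralizer ℝ (act '' (Subgroup.centralizer (H : Set (O n)) : Set (O n)))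

/-- The commutant of `H`. -/
noncomputable def rightAlg (H : Subgroup (O n)) :
    Subalgebra ℝ (End ℝ (EuclideanSpace ℝ (Fin n))) :=
  Subalgebra.centralizer ℝ (act '' (H : Set (O n)))

theorem mem_leftAlg {H : Subgroup (O n)} {T : End ℝ (EuclideanSpace ℝ (Fin n))} :
    T ∈ leftAlg H ↔ ∀ c ∈ Subgroup.centralizer (H : Set (O n)), act c * T = T * act c := by
  rw [leftAlg, Subalgebra.mem_centralizer_iff]
  exact Set.forall_mem_image

theorem mem_rightAlg {H : Subgroup (O n)} {T : End ℝ (EuclideanSpace ℝ (Fin n))} :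
    T ∈ rightAlg H ↔ ∀ h ∈ H, act h * T = T * act h := by
  rw [rightAlg, Subalgebra.mem_centralizer_iff]
  exact Set.forall_mem_image

theorem star_mem_centralizer {K : Subgroup (O n)} {T : End ℝ (EuclideanSpace ℝ (Fin n))}
    (hT : ∀ k ∈ K, act k * T = T * act k) (k : O n) (hk : k ∈ K) :
    act k * star T = star T * act k := by
  have := congrArg star (hT k⁻¹ (K.inv_mem hk))
  simpa [star_act] using this.symm

theorem act_mem_leftAlg {H : Subgroup (O n)} {h : O n} (hh : h ∈ H) : act h ∈ leftAlg H :=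
  mem_leftAlg.mpr fun c hc => by
    rw [← act_mul, ← act_mul, Subgroup.mem_centralizer_iff.mp hc h hh]

theorem act_mem_rightAlg {H : Subgroup (O n)} {c : O n} :
    act c ∈ rightAlg H ↔ c ∈ Subgroup.centralizer (H : Set (O n)) := by
  rw [mem_rightAlg, Subgroup.mem_centralizer_iff]
  refine forall₂_congr fun h _ => ?_
  rw [← act_mul, ← act_mul, act_injective.eq_iff]

theorem mem_of_act_mem_leftAlg {H : Subgroup (O n)} (hH : IsHowe H) {h : O n}
    (hh : act h ∈ leftAlg H) : h ∈ H := by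
  rw [← hH, Subgroup.mem_centralizer_iff]
  intro c hc
  have := mem_leftAlg.mp hh c hc
  rwa [← act_mul, ← act_mul, act_injective.eq_iff] at this

/-- By definition `leftAlg H` commutes only with the centralizer of `H`, that is, with the
orthogonal elements of `rightAlg H`. Those suffice, since `rightAlg H` is the commutant of a
star-closed set. -/
theorem isDualPair (H : Subgroup (O n)) : IsDualPair (leftAlg H) (rightAlg H) := by
  have hcomm : ∀ a ∈ leftAlg H, ∀ b ∈ rightAlg H, b * a = a * b := by
    intro a ha b hb
    refine commute_of_commute_orthogonal (S := act '' (H : Set (O n))) (B := rightAlg H) ?_ ?_ ?_ hb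
    · rintro _ ⟨h, hh, rfl⟩
      exact ⟨h⁻¹, H.inv_mem hh, (star_act h).symm⟩
    · intro T
      exact Subalgebra.mem_centralizer_iff ℝ
    · intro b hb horth
      obtain ⟨c, rfl⟩ := exists_act_eq horth
      exact mem_leftAlg.mp ha c (act_mem_rightAlg.mp hb)
  refine ⟨fun T => ⟨fun hT b hb => (hcomm T hT b hb).symm, fun hT => ?_⟩,
    fun T => ⟨fun hT a ha => (hcomm a ha T hT).symm, fun hT => ?_⟩, fun T hT => ?_, fun T hT => ?_⟩
  · exact mem_leftAlg.mpr fun c hc => (hT _ (act_mem_rightAlg.mpr hc)).symm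
  · exact mem_rightAlg.mpr fun h hh => hT _ (act_mem_leftAlg hh)
  · exact mem_leftAlg.mpr (star_mem_centralizer (mem_leftAlg.mp hT))
  · exact mem_rightAlg.mpr (star_mem_centralizer (mem_rightAlg.mp hT))

/-- For invariant `W`, the projection commutes with `H` and with its centralizer. It then lies in
both algebras, so it commutes with all their elements. -/
theorem stable_iff_isInvariant (H : Subgroup (O n))
    (W : Submodule ℝ (EuclideanSpace ℝ (Fin n))) :
    Stable ((leftAlg H : Set (End ℝ (EuclideanSpace ℝ (Fin n)))) ∪ rightAlg H) W ↔
      IsInvariant H W := by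
  constructor
  · intro hW h hh c hc w hw
    rw [act_mul, Module.End.mul_apply]
    exact hW _ (Or.inl (act_mem_leftAlg hh)) _ (hW _ (Or.inr (act_mem_rightAlg.mpr hc)) _ hw)
  · intro hW
    have hWH : ∀ h ∈ H, ∀ w ∈ W, act h w ∈ W := fun h hh w hw => by
      simpa using hW h hh 1 (one_mem _) w hw
    have hWC : ∀ c ∈ Subgroup.centralizer (H : Set (O n)), ∀ w ∈ W, act c w ∈ W :=
      fun c hc w hw => by simpa using hW 1 (one_mem _) c hc w hw
    have hr : proj W ∈ rightAlg H := mem_rightAlg.mpr fun h hh =>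
      mul_proj_eq_proj_mul (hWH h hh) (by rw [star_act]; exact hWH _ (H.inv_mem hh))
    have hl : proj W ∈ leftAlg H := mem_leftAlg.mpr fun c hc =>
      mul_proj_eq_proj_mul (hWC c hc) (by rw [star_act]; exact hWC _ (inv_mem hc))
    rintro T (hT | hT) x hx
    · exact mem_of_mul_proj_eq ((isDualPair H).comm hT hr) hx
    · exact mem_of_mul_proj_eq ((isDualPair H).comm hl hT).symm hx

theorem irr_iff (H : Subgroup (O n)) (W : Submodule ℝ (EuclideanSpace ℝ (Fin n))) :
    Irr ((leftAlg H : Set (End ℝ (EuclideanSpace ℝ (Fin n)))) ∪ rightAlg H) W ↔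
      IsIrreducibleSubspace H W := by
  simp only [Irr, IsIrreducibleSubspace, stable_iff_isInvariant]

theorem normalizes_act {H : Subgroup (O n)} {g : O n} (hg : conj g H = H) :
    Normalizes (act g) (leftAlg H) := by
  have key : ∀ g : O n, conj g H = H → ∀ a ∈ leftAlg H, act g * a * star (act g) ∈ leftAlg H := by
    intro g hg a ha
    refine mem_leftAlg.mpr fun c hc => ?_
    have hc' : g⁻¹ * c * g ∈ Subgroup.centralizer (H : Set (O n)) := by
      rw [Subgroup.mem_centralizer_iff] at hc ⊢
      intro h hh
      have h1 : g * h * g⁻¹ ∈ H := by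
        rw [← hg, mem_conj]
        simpa [mul_assoc] using hh
      have h2 := hc _ h1
      have h3 : h = g⁻¹ * (g * h * g⁻¹) * g := by group
      rw [h3]
      calc g⁻¹ * (g * h * g⁻¹) * g * (g⁻¹ * c * g) = g⁻¹ * ((g * h * g⁻¹) * c) * g := by group
        _ = g⁻¹ * (c * (g * h * g⁻¹)) * g := by rw [h2]
        _ = _ := by group
    have h4 := mem_leftAlg.mp ha _ hc'
    have h5 : act g * act (g⁻¹ * c * g) = act c * act g := by
      rw [← act_mul, ← act_mul]; congr 1; group
    have h6 : act (g⁻¹ * c * g) * act g⁻¹ = act g⁻¹ * act c := by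
      rw [← act_mul, ← act_mul]; congr 1; group
    rw [star_act]
    calc act c * (act g * a * act g⁻¹) = (act c * act g) * a * act g⁻¹ := by
          simp only [mul_assoc]
      _ = act g * (act (g⁻¹ * c * g) * a) * act g⁻¹ := by rw [← h5]; simp only [mul_assoc]
      _ = act g * a * (act (g⁻¹ * c * g) * act g⁻¹) := by rw [h4]; simp only [mul_assoc]
      _ = act g * a * act g⁻¹ * act c := by rw [h6]; simp only [mul_assoc]
  have hg' : conj g⁻¹ H = H := by
    conv_lhs => rw [← hg, ← conj_mul, inv_mul_cancel, conj_one]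
  refine ⟨star_act_mul_act g, key g hg, fun a ha => ?_⟩
  have := key g⁻¹ hg' a ha
  rwa [star_act, inv_inv, ← star_act] at this

/-! ### Factors -/

section factor

variable {H : Subgroup (O n)} {W : Submodule ℝ (EuclideanSpace ℝ (Fin n))}

/-- In the converse direction, `T` extended by the identity is orthogonal and lies in `leftAlg H`,
hence comes from `H` by the Howe property. -/
theorem exists_restrict_iff (hH : IsHowe H)
    (hW : Irr ((leftAlg H : Set (End ℝ (EuclideanSpace ℝ (Fin n)))) ∪ rightAlg H) W)
    (T : End ℝ W) :
    (∃ h ∈ H, ∀ x : W, act h (x : EuclideanSpace ℝ (Fin n)) = T x) ↔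
      star T * T = 1 ∧ T ∈ restr (leftAlg H) W ((isDualPair H).proj_mem_left_of_irr hW) := by
  have hp := (isDualPair H).proj_mem_left_of_irr hW
  constructor
  · rintro ⟨h, hh, hT⟩
    have he : act h * proj W = extend W T :=
      eq_extend (by rw [mul_assoc, proj_mul_proj]) fun x => by
        rw [Module.End.mul_apply, proj_apply_of_mem x.2, hT]
    constructor
    · apply extend_injective
      rw [extend_mul, extend_star, ← he, extend_one, star_mul, star_proj, mul_assoc,
        ← mul_assoc (star (act h)), star_act_mul_act, one_mul, proj_mul_proj]
    · rw [mem_restr, ← he]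
      exact (leftAlg H).mul_mem (act_mem_leftAlg hh) hp
  · rintro ⟨horth, hT⟩
    have e1 : (1 - proj W) * extend W T = 0 := by
      rw [sub_mul, proj_mul_extend, one_mul, sub_self]
    have e2 : star (extend W T) * (1 - proj W) = 0 := by
      rw [← extend_star, mul_sub, extend_mul_proj, mul_one, sub_self]
    have e3 : (1 - proj W) * (1 - proj W) = 1 - proj W := by
      simp [mul_sub, sub_mul, proj_mul_proj]
    obtain ⟨h, hh⟩ := exists_act_eq (T := extend W T + (1 - proj W)) (by
      rw [star_add, star_sub, star_one, star_proj, add_mul, mul_add, mul_add, e1, e2, e3,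
        ← extend_star, ← extend_mul, horth, extend_one]
      abel)
    refine ⟨h, mem_of_act_mem_leftAlg hH ?_, fun x => ?_⟩
    · rw [hh]
      exact (leftAlg H).add_mem hT ((leftAlg H).sub_mem (leftAlg H).one_mem hp)
    · rw [hh, LinearMap.add_apply, extend_coe, LinearMap.sub_apply, Module.End.one_apply,
        proj_apply_of_mem x.2, sub_self, add_zero]

variable {ι : Type} [Fintype ι] [DecidableEq ι]

theorem repr_symm_toEuclideanLin (w : OrthonormalBasis ι ℝ W) (M : Matrix ι ι ℝ)
    (x : EuclideanSpace ℝ ι) :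
    w.repr.symm (Matrix.toEuclideanLin M x) =
      (LinearMap.toMatrixOrthonormal w).symm M (w.repr.symm x) := by
  obtain ⟨T, rfl⟩ := EquivLike.surjective (LinearMap.toMatrixOrthonormal w) M
  rw [StarAlgEquiv.symm_apply_apply, LinearIsometryEquiv.symm_apply_eq]
  have h := LinearMap.toMatrix_mulVec_repr w.toBasis w.toBasis T (w.repr.symm x)
  ext i
  have h2 := congrFun h i
  simp only [OrthonormalBasis.coe_toBasis_repr_apply] at h2
  rw [← h2]
  simp only [Matrix.ofLp_toLpLin, Matrix.toLin'_apply]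
  congr 1
  ext j
  simp

theorem hasFactor_iff (hH : IsHowe H) (F : Set (Matrix ι ι ℝ)) :
    HasFactor H F ↔ ∃ (W : Submodule ℝ (EuclideanSpace ℝ (Fin n)))
      (hW : Irr ((leftAlg H : Set (End ℝ (EuclideanSpace ℝ (Fin n)))) ∪ rightAlg H) W)
      (w : OrthonormalBasis ι ℝ W), ∀ T : End ℝ W,
        LinearMap.toMatrixOrthonormal w T ∈ F ↔ star T * T = 1 ∧
          T ∈ restr (leftAlg H) W ((isDualPair H).proj_mem_left_of_irr hW) := by
  have key : ∀ (W : Submodule ℝ (EuclideanSpace ℝ (Fin n))) (w : OrthonormalBasis ι ℝ W)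
      (h : O n) (T : End ℝ W),
      (∀ x : EuclideanSpace ℝ ι, act h (w.repr.symm x : EuclideanSpace ℝ (Fin n)) =
        (w.repr.symm (Matrix.toEuclideanLin (LinearMap.toMatrixOrthonormal w T) x) : W)) ↔
      ∀ x : W, act h (x : EuclideanSpace ℝ (Fin n)) = T x := by
    intro W w h T
    simp only [repr_symm_toEuclideanLin, StarAlgEquiv.symm_apply_apply]
    constructor
    · intro hx x
      have := hx (w.repr x)
      simpa using this
    · intro hx x
      exact hx _
  constructor
  · rintro ⟨W, hW, e, he⟩
    refine ⟨W, (irr_iff H W).mpr hW, OrthonormalBasis.ofRepr e.symm, fun T => ?_⟩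
    rw [← exists_restrict_iff hH ((irr_iff H W).mpr hW), ← he]
    simp only [← key W (OrthonormalBasis.ofRepr e.symm)]
    rfl
  · rintro ⟨W, hW, w, hw⟩
    refine ⟨W, (irr_iff H W).mp hW, w.repr.symm, ?_⟩
    ext M
    obtain ⟨T, rfl⟩ := EquivLike.surjective (LinearMap.toMatrixOrthonormal w) M
    rw [hw, ← exists_restrict_iff hH hW]
    simp only [← key W w]
    rfl

/-- The involution of `W` with matrix `M`, extended by the identity, serves as `g`: conjugation by
it preserves the factor on `W` and changes nothing on the orthogonal complement. -/
theorem exists_conj_eq_of_factor (hH : IsHowe H) {F : Set (Matrix ι ι ℝ)} (hF : HasFactor H F)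
    {M : Matrix ι ι ℝ} (hM : M.transpose = M) (hMM : M * M = 1)
    (hMF : ∀ N ∈ F, M * N * M ∈ F) :
    ∃ g : O n, (g : Matrix (Fin n) (Fin n) ℝ).det = M.det ∧ conj g H = H := by
  obtain ⟨W, hW, w, hw⟩ := (hasFactor_iff hH F).mp hF
  have hp := (isDualPair H).proj_mem_left_of_irr hW
  have hpr := (isDualPair H).proj_mem_right_of_irr hW
  obtain ⟨T, rfl⟩ := EquivLike.surjective (LinearMap.toMatrixOrthonormal w) M
  have hTs : star T = T := by
    apply EquivLike.injective (LinearMap.toMatrixOrthonormal w)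
    rw [map_star, Matrix.star_eq_conjTranspose, Matrix.conjTranspose_eq_transpose_of_trivial, hM]
  have hTT : T * T = 1 := by
    apply EquivLike.injective (LinearMap.toMatrixOrthonormal w)
    rw [map_mul, hMM, map_one]
  have e1 : (1 - proj W) * extend W T = 0 := by
    rw [sub_mul, proj_mul_extend, one_mul, sub_self]
  have e2 : extend W T * (1 - proj W) = 0 := by
    rw [mul_sub, extend_mul_proj, mul_one, sub_self]
  have e3 : (1 - proj W) * (1 - proj W) = 1 - proj W := by
    simp [mul_sub, sub_mul, proj_mul_proj]
  set c := extend W T + (1 - proj W) with hc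
  have hcs : star c = c := by
    rw [hc, star_add, ← extend_star, hTs, star_sub, star_one, star_proj]
  have hcc : c * c = 1 := by
    rw [hc, add_mul, mul_add, mul_add, e1, e2, e3, ← extend_mul, hTT, extend_one]
    abel
  obtain ⟨g, hg⟩ := exists_act_eq (T := c) (by rw [hcs, hcc])
  have hginv : g⁻¹ = g := by
    apply act_injective
    rw [← star_act, hg, hcs]
  have hconj : ∀ h ∈ H, g * h * g ∈ H := by
    intro h hh
    apply mem_of_act_mem_leftAlg hH
    have hA := act_mem_leftAlg hh
    have hhp : act h * proj W = proj W * act h := (isDualPair H).comm hA hpr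
    let Th : End ℝ W := (act h).restrict fun x hx => mem_of_mul_proj_eq hhp hx
    have hTh : act h * proj W = extend W Th :=
      eq_extend (by rw [mul_assoc, proj_mul_proj]) fun x => by
        rw [Module.End.mul_apply, proj_apply_of_mem x.2]; rfl
    have hThF := (hw Th).mpr ((exists_restrict_iff hH hW Th).mp ⟨h, hh, fun x => rfl⟩)
    have h1 := hMF _ hThF
    rw [← map_mul, ← map_mul, hw] at h1
    have h2 : extend W T * act h = extend W (T * Th) := by
      rw [extend_mul, ← hTh, hhp, ← mul_assoc, extend_mul_proj]
    have h3 : (1 - proj W) * act h = act h * (1 - proj W) := by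
      rw [mul_sub, sub_mul, hhp, mul_one, one_mul]
    have h4 : extend W (T * Th) * (1 - proj W) = 0 := by
      rw [mul_sub, extend_mul_proj, mul_one, sub_self]
    have h5 : act (g * h * g) = extend W (T * Th * T) + act h * (1 - proj W) := by
      rw [act_mul, act_mul, hg, hc, add_mul, h2, h3, add_mul, mul_add, mul_add, h4,
        ← extend_mul, mul_assoc (act h), mul_assoc (act h), e1, e3]
      simp
    rw [h5]
    exact (leftAlg H).add_mem h1.2 ((leftAlg H).mul_mem hA
      ((leftAlg H).sub_mem (leftAlg H).one_mem hp))
  refine ⟨g, by rw [← det_act, hg, hc, det_extend_add, det_toMatrixOrthonormal], ?_⟩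
  ext x
  rw [mem_conj, hginv]
  refine ⟨fun hx => ?_, hconj x⟩
  have := hconj _ hx
  have hgg : g * g = 1 := mul_eq_one_iff_inv_eq.mpr hginv
  have e : g * (g * x * g) * g = (g * g) * x * (g * g) := by simp only [mul_assoc]
  rwa [e, hgg, one_mul, mul_one] at this

end factor

/-! ### Standard factors -/

theorem kronecker_one_injective {ι : Type*} {k : ℕ} (hk : 0 < k) {X Y : Matrix ι ι ℝ}
    (h : X ⊗ₖ (1 : Matrix (Fin k) (Fin k) ℝ) = Y ⊗ₖ (1 : Matrix (Fin k) (Fin k) ℝ)) : X = Y := by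
  ext i j
  have := congrFun (congrFun h (i, ⟨0, hk⟩)) (j, ⟨0, hk⟩)
  simpa [Matrix.kroneckerMap_apply] using this

theorem fieldRestriction_mul {m : ℕ} (a b : Matrix (Fin m) (Fin m) ℂ) :
    fieldRestriction (a * b) = fieldRestriction a * fieldRestriction b := by
  simp only [fieldRestriction, Matrix.fromBlocks_multiply]
  congr 1 <;> ext i j <;>
    simp [Matrix.mul_apply, Finset.sum_add_distrib, Finset.sum_sub_distrib] <;> ring

theorem transpose_fieldRestriction {m : ℕ} (a : Matrix (Fin m) (Fin m) ℂ) :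
    (fieldRestriction a).transpose = fieldRestriction (star a) := by
  ext (i | i) (j | j) <;> simp [fieldRestriction]

theorem fieldRestriction_injective {m : ℕ} :
    Function.Injective (fieldRestriction (m := m)) := by
  intro a b h
  obtain ⟨h1, h2, -, -⟩ := Matrix.fromBlocks_inj.mp h
  ext i j
  exact Complex.ext (congrFun (congrFun h1 i) j) (congrFun (congrFun h2 i) j)

/-- For positive `k` the map `a ↦ a ⊗ 1` is injective, so orthogonality of the tensor product forces
that of `a`. -/
theorem mem_stdO_iff {m k : ℕ} (hk : 0 < k) (M : Matrix (Fin m × Fin k) (Fin m × Fin k) ℝ) :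
    M ∈ stdO m k ↔ M.transpose * M = 1 ∧ ∃ a : Matrix (Fin m) (Fin m) ℝ,
      M = a ⊗ₖ (1 : Matrix (Fin k) (Fin k) ℝ) := by
  have key : ∀ a : Matrix (Fin m) (Fin m) ℝ, a ∈ Matrix.orthogonalGroup (Fin m) ℝ ↔
      (a ⊗ₖ (1 : Matrix (Fin k) (Fin k) ℝ)).transpose * (a ⊗ₖ (1 : Matrix (Fin k) (Fin k) ℝ)) =
        1 := by
    intro a
    rw [Matrix.mem_orthogonalGroup_iff', ← Matrix.kroneckerMap_transpose, ← Matrix.mul_kronecker_mul,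
      Matrix.transpose_one, mul_one]
    constructor
    · intro h
      rw [h, Matrix.one_kronecker_one]
    · intro h
      exact kronecker_one_injective hk (h.trans Matrix.one_kronecker_one.symm)
  constructor
  · rintro ⟨a, ha, rfl⟩
    exact ⟨(key a).mp ha, a, rfl⟩
  · rintro ⟨h, a, rfl⟩
    exact ⟨a, (key a).mpr h, rfl⟩

theorem mem_stdU_iff {m k : ℕ} (hk : 0 < k)
    (M : Matrix ((Fin m ⊕ Fin m) × Fin k) ((Fin m ⊕ Fin m) × Fin k) ℝ) :
    M ∈ stdU m k ↔ M.transpose * M = 1 ∧ ∃ a : Matrix (Fin m) (Fin m) ℂ,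
      M = fieldRestriction a ⊗ₖ (1 : Matrix (Fin k) (Fin k) ℝ) := by
  have key : ∀ a : Matrix (Fin m) (Fin m) ℂ, a ∈ Matrix.unitaryGroup (Fin m) ℂ ↔
      (fieldRestriction a ⊗ₖ (1 : Matrix (Fin k) (Fin k) ℝ)).transpose *
        (fieldRestriction a ⊗ₖ (1 : Matrix (Fin k) (Fin k) ℝ)) = 1 := by
    intro a
    rw [Matrix.mem_unitaryGroup_iff', ← Matrix.kroneckerMap_transpose, ← Matrix.mul_kronecker_mul,
      Matrix.transpose_one, mul_one, transpose_fieldRestriction, ← fieldRestriction_mul]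
    constructor
    · intro h
      rw [h, fieldRestriction_one, Matrix.one_kronecker_one]
    · intro h
      refine fieldRestriction_injective (kronecker_one_injective hk ?_)
      rw [h, fieldRestriction_one, Matrix.one_kronecker_one]
  constructor
  · rintro ⟨a, ha, rfl⟩
    exact ⟨(key a).mp ha, a, rfl⟩
  · rintro ⟨h, a, rfl⟩
    exact ⟨a, (key a).mpr h, rfl⟩

theorem transpose_mul_self_toMatrixOrthonormal {E : Type*} [NormedAddCommGroup E]
    [InnerProductSpace ℝ E] [FiniteDimensional ℝ E] {ι : Type*} [Fintype ι] [DecidableEq ι]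
    (w : OrthonormalBasis ι ℝ E) (T : End ℝ E) :
    (LinearMap.toMatrixOrthonormal w T).transpose * LinearMap.toMatrixOrthonormal w T = 1 ↔
      star T * T = 1 := by
  rw [← Matrix.conjTranspose_eq_transpose_of_trivial, ← Matrix.star_eq_conjTranspose, ← map_star,
    ← map_mul, ← map_one (LinearMap.toMatrixOrthonormal w), EmbeddingLike.apply_eq_iff_eq]

theorem nonempty_of_hasFactor {H : Subgroup (O n)} {ι : Type} [Fintype ι] [DecidableEq ι]
    {F : Set (Matrix ι ι ℝ)} (hF : HasFactor H F) : Nonempty ι := by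
  obtain ⟨W, hW, e, -⟩ := hF
  by_contra hι
  rw [not_nonempty_iff] at hι
  refine hW.2.1 ((Submodule.eq_bot_iff _).mpr fun x hx => ?_)
  have : e.symm ⟨x, hx⟩ = 0 := Subsingleton.elim _ _
  simpa using this

/-- For an `O`-factor of odd rank take `1 ⊗ D`, which centralizes the factor; for one of odd
multiplicity take `D ⊗ 1`, which belongs to it. For a `U`-factor take complex conjugation, which
sends `a` to its entrywise conjugate. -/
theorem exists_conj_eq_of_hasOddFactor {H : Subgroup (O n)} (hH : IsHowe H)
    (h : HasOddFactor H) : ∃ g : O n, (g : Matrix (Fin n) (Fin n) ℝ).det = -1 ∧ conj g H = H := by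
  rcases h with ⟨m, k, hF, hodd⟩ | ⟨m, k, hF, hm, hk⟩
  -- Irreducible subspaces are nonzero, so rank and multiplicity are positive and the reflection `D`
  -- exists.
  · obtain ⟨⟨i, l⟩⟩ := nonempty_of_hasFactor hF
    rcases hodd with hm | hk
    · obtain ⟨D, hD, hDD, hdet⟩ := exists_reflection_matrix l.pos
      obtain ⟨g, hg, hgH⟩ := exists_conj_eq_of_factor hH hF
        (M := (1 : Matrix (Fin m) (Fin m) ℝ) ⊗ₖ D)
        (by rw [← Matrix.kroneckerMap_transpose, Matrix.transpose_one, hD])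
        (by rw [← Matrix.mul_kronecker_mul, hDD, mul_one, Matrix.one_kronecker_one])
        (by
          rintro _ ⟨a, ha, rfl⟩
          refine ⟨a, ha, ?_⟩
          rw [← Matrix.mul_kronecker_mul, ← Matrix.mul_kronecker_mul]
          simp [hDD])
      refine ⟨g, ?_, hgH⟩
      rw [hg, Matrix.det_kronecker, hdet]
      simp [hm.neg_one_pow]
    · obtain ⟨D, hD, hDD, hdet⟩ := exists_reflection_matrix i.pos
      have hDO : D ∈ Matrix.orthogonalGroup (Fin m) ℝ :=
        (Matrix.mem_orthogonalGroup_iff _ _).mpr (by rw [hD, hDD])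
      obtain ⟨g, hg, hgH⟩ := exists_conj_eq_of_factor hH hF
        (M := D ⊗ₖ (1 : Matrix (Fin k) (Fin k) ℝ))
        (by rw [← Matrix.kroneckerMap_transpose, Matrix.transpose_one, hD])
        (by rw [← Matrix.mul_kronecker_mul, hDD, mul_one, Matrix.one_kronecker_one])
        (by
          rintro _ ⟨a, ha, rfl⟩
          refine ⟨D * a * D, mul_mem (mul_mem hDO ha) hDO, ?_⟩
          rw [← Matrix.mul_kronecker_mul, ← Matrix.mul_kronecker_mul, mul_one, mul_one])
      refine ⟨g, ?_, hgH⟩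
      rw [hg, Matrix.det_kronecker, hdet]
      simp [hk.neg_one_pow]
  · let Q : Matrix (Fin m ⊕ Fin m) (Fin m ⊕ Fin m) ℝ := Matrix.fromBlocks 1 0 0 (-1)
    have hQQ : Q * Q = 1 := by simp [Q, Matrix.fromBlocks_multiply]
    have hQ : Q.transpose = Q := by simp [Q, Matrix.fromBlocks_transpose]
    obtain ⟨g, hg, hgH⟩ := exists_conj_eq_of_factor hH hF
      (M := Q ⊗ₖ (1 : Matrix (Fin k) (Fin k) ℝ))
      (by rw [← Matrix.kroneckerMap_transpose, Matrix.transpose_one, hQ])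
      (by rw [← Matrix.mul_kronecker_mul, hQQ, mul_one, Matrix.one_kronecker_one])
      (by
        rintro _ ⟨a, ha, rfl⟩
        refine ⟨a.map (starRingEnd ℂ), ?_, ?_⟩
        · rw [Matrix.mem_unitaryGroup_iff'] at ha ⊢
          have h1 := congrArg (fun X => X.map (starRingEnd ℂ)) ha
          simp only [Matrix.map_mul] at h1
          rw [Matrix.map_one _ (map_zero _) (map_one _)] at h1
          exact h1
        · rw [← Matrix.mul_kronecker_mul, ← Matrix.mul_kronecker_mul, mul_one, mul_one]
          congr 1
          simp only [Q, fieldRestriction, Matrix.fromBlocks_multiply]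
          ext (i | i) (j | j) <;> simp)
    refine ⟨g, ?_, hgH⟩
    rw [hg, Matrix.det_kronecker]
    simp [Q, Matrix.det_neg, hm.neg_one_pow, hk.neg_one_pow]

theorem hasOddFactor_of_conj_eq {H : Subgroup (O n)} (hH : IsHowe H) {g : O n}
    (hg : (g : Matrix (Fin n) (Fin n) ℝ).det = -1) (hgH : conj g H = H) : HasOddFactor H := by
  obtain ⟨W, hW, hodd⟩ := (isDualPair H).exists_irr_hasOddType (normalizes_act hgH)
    (by rw [det_act, hg])
  have hnt : Nontrivial W := Submodule.nontrivial_iff_ne_bot.mpr hW.2.1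
  rcases hodd with ⟨m, k, hmk, w, hw⟩ | ⟨m, k, hm, hk, w, hw⟩
  · obtain ⟨⟨i, l⟩⟩ := w.toBasis.index_nonempty
    refine Or.inl ⟨m, k, (hasFactor_iff hH _).mpr ⟨W, hW, w, fun T => ?_⟩, hmk⟩
    rw [mem_stdO_iff l.pos, transpose_mul_self_toMatrixOrthonormal, hw]
  · obtain ⟨⟨i, l⟩⟩ := w.toBasis.index_nonempty
    refine Or.inr ⟨m, k, (hasFactor_iff hH _).mpr ⟨W, hW, w, fun T => ?_⟩, hm, hk⟩
    rw [mem_stdU_iff l.pos, transpose_mul_self_toMatrixOrthonormal, hw]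

theorem hasOddFactor_iff {H : Subgroup (O n)} (hH : IsHowe H) :
    HasOddFactor H ↔ ∃ g : O n, (g : Matrix (Fin n) (Fin n) ℝ).det = -1 ∧ conj g H = H :=
  ⟨exists_conj_eq_of_hasOddFactor hH, fun ⟨_, hg, hgH⟩ => hasOddFactor_of_conj_eq hH hg hgH⟩

end Howe

theorem proposition3p8 (n : ℕ) (hn : Even n) (hpos : 0 < n) (H : Subgroup (Howe.O n))
    (hH : Howe.IsSAdmissible H) :
    (∀ C ∈ Howe.inducedClasses H, ∀ K ∈ C, Howe.IsHowe K) ∧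
    ((∃ C, Howe.inducedClasses H = {C}) ↔ Howe.HasOddFactor H) ∧
    (¬ Howe.HasOddFactor H →
      ∃ a : Howe.O n, (a : Matrix (Fin n) (Fin n) ℝ).det < 0 ∧
        Howe.conjClass (Howe.S H) ≠ Howe.conjClass (Howe.S (Howe.conj a H)) ∧
        Howe.inducedClasses H =
          {Howe.conjClass (Howe.S H), Howe.conjClass (Howe.S (Howe.conj a H))}) := by
  obtain ⟨a, ha⟩ := Howe.exists_det_eq_neg_one hpos
  have hclasses := Howe.inducedClasses_eq H ha
  have hodd := (Howe.conjClass_eq_iff hH ha).trans (Howe.hasOddFactor_iff hH.1).symm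
  refine ⟨fun C hC K hK => Howe.isHowe_of_mem_inducedClasses hH.2.1 hC hK, ?_, fun h =>
    ⟨a, by rw [ha]; norm_num, fun he => h (hodd.mp he), hclasses⟩⟩
  rw [← hodd, hclasses]
  constructor
  · rintro ⟨C, hC⟩
    have h1 := hC ▸ Set.mem_insert (Howe.conjClass (Howe.S H)) {Howe.conjClass (Howe.S (Howe.conj a H))}
    have h2 := hC ▸ Set.mem_insert_of_mem (Howe.conjClass (Howe.S H))
      (Set.mem_singleton (Howe.conjClass (Howe.S (Howe.conj a H))))
    exact (Set.mem_singleton_iff.mp h1).trans (Set.mem_singleton_iff.mp h2).symm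
  · intro he
    exact ⟨_, by rw [← he, Set.pair_eq_singleton]⟩
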